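/- Let $E$ be a set with a total order $<$, and let $I\subseteq E\times E$ be an irreflexive symmetric relation (the independence relation). Let $M(E,I)$ be the trace monoid, i.e. the quotient of the free monoid $E^*$ by the congruence generated by $ab=ba$ for $(a,b)\in I$. Factorization category. For a monoid $M$, $Fact(M)$ has the elements of $M$ as objects; a morphism $\alpha\to\beta$ is a pair $(f,g)\in M\times M$ with $g\alpha f=\beta$, and $(f',g')\circ(f,g)=(ff',g'g)$. Homology of a small category. For a small category $\mathcal C$ and a functor $F:\mathcal C\to\mathrm{Ab}$, $H_n(\mathcal C,F)$ is the $n$-th homology of the complex $C_n(\mathcal C,F)=\bigoplus_{c_0\to\cdots\to c_n}F(c_0)$ with $d_n=\sum_{i=0}^n(-1)^i d_i$, where $d_i$ deletes $c_i$ (composing the two adjacent arrows if $0<i<n$), is the identity of $F(c_0)$ on coefficients for $i>0$, and applies $F(c_0\to c_1)$ for $i=0$. The groups $H_n(Fact(M)^{op},F)$, for $F:Fact(M)^{op}\to\mathrm{Ab}$, are the Leech homology groups of $M$. Cubical homology. Let $\Box_+$ be the category of the posets $\{0,1\}^n$, $n\ge 0$, whose morphisms are the compositions of the maps $\delta_i^{n,\varepsilon}:\{0,1\}^{n-1}\to\{0,1\}^n$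 that insert $\varepsilon\in\{0,1\}$ as the $i$-th coordinate. A semicubical set is a functor $X:\Box_+^{op}\to\mathrm{Set}$; put $X_n=X(\{0,1\}^n)$ and $\partial_i^{n,\varepsilon}=X(\delta_i^{n,\varepsilon})$. Let $\Box_+/X$ be the category whose objects are the elements $\sigma\in\coprod_n X_n$ and whose morphisms from $\sigma\in X_m$ to $\tau\in X_n$ are the morphisms $\alpha:\{0,1\}^m\to\{0,1\}^n$ of $\Box_+$ with $X(\alpha)(\tau)=\sigma$. For $G:(\Box_+/X)^{op}\to\mathrm{Ab}$, $H_n(X,G)$ is the $n$-th homology of the complex $C_n(X,G)=\bigoplus_{\sigma\in X_n}G(\sigma)$ with $d_n=\sum_{i=1}^n(-1)^i(d_i^{n,1}-d_i^{n,0})$, where $d_i^{n,\varepsilon}$ maps the summand of $\sigma$ to the summand of $\partial_i^{n,\varepsilon}\sigma$ by $G$ applied to the morphism $\partial_i^{n,\varepsilon}\sigma\to\sigma$ given by $\delta_i^{n,\varepsilon}$. Generalized torus. $T(E,I)$ is the semicubical set with $T_n(E,I)=\{(a_1,\dots,a_n)\in E^n : a_i<a_j \text{ and } (a_i,a_j)\in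 I \text{ for all } i<j\}$ and $\partial_i^{n,\varepsilon}(a_1,\dots,a_n)=(a_1,\dots,a_{i-1},a_{i+1},\dots,a_n)$. Let $\mathfrak S:\Box_+/T(E,I)\to Fact(M(E,I))$ be the functor with $\mathfrak S(a_1,\dots,a_n)=a_1\cdots a_n$ which sends the morphism $(a_1,\dots,a_{i-1},a_{i+1},\dots,a_n)\to(a_1,\dots,a_n)$ given by $\delta_i^{n,\varepsilon}$ to the pair $(f,g)=(a_i^{1-\varepsilon},a_i^{\varepsilon})$. Theorem. Suppose that $E$ contains no infinite subset of pairwise independent elements (that is, every $A\subseteq E$ such that $(a,b)\in I$ for all distinct $a,b\in A$ is finite). Then for every $n\ge 0$ there is an isomorphism $$H_n(Fact(M(E,I))^{op},F)\;\cong\; H_n(T(E,I),F\circ\mathfrak S^{op}),$$ natural in $F:Fact(M(E,I))^{op}\to\mathrm{Ab}$. If moreover $E$ is finite, then the complex $C_\bullet(T(E,I),F\circ\mathfrak S^{op})$, which computes the Leech homology, is finite: the set $\coprod_{n\ge0}T_n(E,I)$ of its summands is finite, and $C_n(T(E,I),F\circ\mathfrak S^{op})=0$ for every $n>|E|$ and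 every $F$. -/

import Mathlib

open CategoryTheory Opposite
open scoped DirectSum

universe u v w

/-! ### Direct sums of abelian groups -/

/-- The direct sum `⨁ i, A i` as an object of the category of abelian groups. -/
noncomputable def abSum {ι : Type u}  (A : ι → AddCommGrpCat.{w}) : AddCommGrpCat.{max u w} :=
  AddCommGrpCat.of (⨁ i, A i)
/-- The element `(i, a)` of the direct sum `⨁ i, A i`, for `a ∈ A i`. -/
noncomputable def abSumOf {ι : Type u}  (A : ι → AddCommGrpCat.{w}) (i : ι) (a : A i) : abSum A :=
  open Classical in DirectSum.of (fun i => A i) i a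

theorem abSum_ext {ι : Type u}  {A : ι → AddCommGrpCat.{w}} {B : AddCommGrpCat.{max u w}}
    (f g : abSum A ⟶ B) (h : ∀ i a, f (abSumOf A i a) = g (abSumOf A i a)) : f = g := by
  classical
  refine AddCommGrpCat.hom_ext (DirectSum.addHom_ext fun i a => ?_)
  exact h i a

/-- The homomorphism `⨁ i, A i → ⨁ j, B j` which sends `(i, a)` to `(f i, φ i a)`. -/
noncomputable def abSumMap {ι κ : Type u} {A : ι → AddCommGrpCat.{w}} {B : κ → AddCommGrpCat.{w}}
    (f : ι → κ) (φ : ∀ i, A i ⟶ B (f i)) : abSum A ⟶ abSum B :=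
  open Classical in
  AddCommGrpCat.ofHom
    (DirectSum.toAddMonoid fun i => (DirectSum.of (fun j => B j) (f i)).comp (φ i).hom)

theorem abSumMap_of {ι κ : Type u}  {A : ι → AddCommGrpCat.{w}} {B : κ → AddCommGrpCat.{w}}
    (f : ι → κ) (φ : ∀ i, A i ⟶ B (f i)) (i : ι) (a : A i) :
    abSumMap f φ (abSumOf A i a) = abSumOf B (f i) (φ i a) := by
  classical
  exact DirectSum.toAddMonoid_of _ _ _

theorem abSumMap_ext {ι κ : Type u} {A : ι → AddCommGrpCat.{w}} {B : κ → AddCommGrpCat.{w}}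
    (f g : ι → κ) (φ : ∀ i, A i ⟶ B (f i)) (ψ : ∀ i, A i ⟶ B (g i))
    (h : ∀ i a, abSumOf B (f i) (φ i a) = abSumOf B (g i) (ψ i a)) :
    abSumMap f φ = abSumMap g ψ :=
  abSum_ext _ _ fun i a => by rw [abSumMap_of, abSumMap_of, h]

theorem abSumMap_id {ι : Type u} (A : ι → AddCommGrpCat.{w}) :
    abSumMap (fun i => i) (fun i => 𝟙 (A i)) = 𝟙 (abSum A) :=
  abSum_ext _ _ fun i a => by rw [abSumMap_of]; rfl

theorem abSumMap_comp {ι κ μ : Type u} {A : ι → AddCommGrpCat.{w}} {B : κ → AddCommGrpCat.{w}}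
    {D : μ → AddCommGrpCat.{w}} (f : ι → κ) (φ : ∀ i, A i ⟶ B (f i))
    (g : κ → μ) (ψ : ∀ i, B i ⟶ D (g i)) :
    abSumMap f φ ≫ abSumMap g ψ = abSumMap (fun i => g (f i)) (fun i => φ i ≫ ψ (f i)) :=
  abSum_ext _ _ fun i a => by
    rw [AddCommGrpCat.comp_apply, abSumMap_of, abSumMap_of, abSumMap_of]; rfl

/-! ### Homology of a small category with coefficients in a functor -/

section CategoryHomology

variable (C : Type u) [Category.{v} C]

/-- The simplicial abelian group with `n`-simplices `⨁_{c₀ → ⋯ → cₙ} F(c₀)`; the sum runs over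
all chains of `n` composable morphisms, identities included.  A simplicial operator `θ` sends
`(c, a)` to `(θ* c, F(c₀ → c_{θ 0}) a)`. -/
noncomputable def simplicialChains (F : C ⥤ AddCommGrpCat.{w}) :
    SimplicialObject AddCommGrpCat.{max u v w} where
  obj Δ := abSum fun c : ComposableArrows C Δ.unop.len => F.obj (c.obj 0)
  map {Δ _} θ := abSumMap
    (fun c : ComposableArrows C Δ.unop.len =>
      c.whiskerLeft (SimplexCategory.toCat.map θ.unop).toFunctor)
    (fun c => F.map (c.map (homOfLE (Fin.zero_le (θ.unop.toOrderHom 0)))))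
  map_id Δ := by
    have h : ∀ c : ComposableArrows C Δ.unop.len,
        F.map (c.map (homOfLE (Fin.zero_le (0 : Fin (Δ.unop.len + 1))))) = 𝟙 (F.obj (c.obj 0)) :=
      fun c => (congrArg F.map (c.map_id 0)).trans (F.map_id _)
    exact (congrArg (abSumMap fun c => c) (funext h)).trans (abSumMap_id _)
  map_comp {Δ₁ Δ₂ Δ₃} f g := by
    refine Eq.trans ?_ (abSumMap_comp _ _ _ _).symm
    refine congrArg (abSumMap _) (funext fun c => ?_)
    exact (congrArg F.map (c.map_comp (homOfLE (Fin.zero_le (f.unop.toOrderHom 0)))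
      (homOfLE (f.unop.toOrderHom.monotone (Fin.zero_le (g.unop.toOrderHom 0)))))).trans
      (F.map_comp _ _)

/-- The map `⨁ F(c₀) → ⨁ G(c₀)` of simplicial abelian groups induced by `F → G`. -/
noncomputable def simplicialChainsMap {F G : C ⥤ AddCommGrpCat.{w}} (η : F ⟶ G) :
    simplicialChains C F ⟶ simplicialChains C G where
  app Δ := abSumMap (fun c : ComposableArrows C Δ.unop.len => c) (fun c => η.app (c.obj 0))
  naturality Δ Δ' θ := by
    refine (abSumMap_comp _ _ _ _).trans (Eq.trans ?_ (abSumMap_comp _ _ _ _).symm)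
    exact congrArg (abSumMap _) (funext fun c => η.naturality _)

/-- `simplicialChains C F` as a functor of `F`. -/
noncomputable def simplicialChainsFunctor :
    (C ⥤ AddCommGrpCat.{w}) ⥤ SimplicialObject AddCommGrpCat.{max u v w} where
  obj F := simplicialChains C F
  map η := simplicialChainsMap C η
  map_id F := NatTrans.ext (funext fun _ => abSumMap_id _)
  map_comp {F G H} η θ := by
    refine NatTrans.ext (funext fun Δ => ?_)
    exact (abSumMap_comp (fun c : ComposableArrows C Δ.unop.len => c) (fun c => η.app (c.obj 0))
      (fun c => c) (fun c => θ.app (c.obj 0))).symm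

/-- The chain complex `C_⋄(C, F)`, with `Cₙ = ⨁_{c₀ → ⋯ → cₙ} F(c₀)` and
`dₙ = ∑_{i=0}^{n} (-1)ⁱ dᵢ`, as a functor of `F`. -/
noncomputable def categoryChains :
    (C ⥤ AddCommGrpCat.{w}) ⥤ ChainComplex AddCommGrpCat.{max u v w} ℕ :=
  simplicialChainsFunctor C ⋙ AlgebraicTopology.alternatingFaceMapComplex _

/-- `Hₙ(C, F)` as a functor of `F`. -/
noncomputable def categoryHomology (n : ℕ) :
    (C ⥤ AddCommGrpCat.{w}) ⥤ AddCommGrpCat.{max u v w} :=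
  categoryChains C ⋙ HomologicalComplex.homologyFunctor _ _ n

end CategoryHomology

/-! ### The box category and semicubical sets -/

/-- The objects of the box category: `⟨n⟩` stands for the poset `{0,1}ⁿ`. -/
structure Box where
  dim : ℕ

/-- The map `{0,1}ⁿ → {0,1}ⁿ⁺¹` which inserts `ε` as the `i`-th coordinate. -/
def boxFace (n : ℕ) (i : Fin (n + 1)) (ε : Bool) : (Fin n → Bool) →o (Fin (n + 1) → Bool) where
  toFun x := i.insertNth ε x
  monotone' x y h := by
    intro j
    induction j using Fin.succAboveCases i with
    | x => simp
    | p j => simpa using h j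

/-- The increasing maps which are compositions of the maps `boxFace n i ε`. -/
inductive IsBoxMap : ∀ {m n : ℕ}, ((Fin m → Bool) →o (Fin n → Bool)) → Prop
  | id (n : ℕ) : IsBoxMap (OrderHom.id : (Fin n → Bool) →o (Fin n → Bool))
  | face (n : ℕ) (i : Fin (n + 1)) (ε : Bool) : IsBoxMap (boxFace n i ε)
  | comp {l m n : ℕ} {ψ : (Fin m → Bool) →o (Fin n → Bool)}
      {φ : (Fin l → Bool) →o (Fin m → Bool)} :
      IsBoxMap ψ → IsBoxMap φ → IsBoxMap (ψ.comp φ)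

/-- Morphisms of the box category. -/
@[ext]
structure Box.Hom (m n : Box) where
  map : (Fin m.dim → Bool) →o (Fin n.dim → Bool)
  isBoxMap : IsBoxMap map

instance : Category Box where
  Hom := Box.Hom
  id n := ⟨OrderHom.id, .id n.dim⟩
  comp φ ψ := ⟨ψ.map.comp φ.map, .comp ψ.isBoxMap φ.isBoxMap⟩

/-- The morphism `δᵢ^{n+1,ε} : {0,1}ⁿ → {0,1}ⁿ⁺¹` of the box category. -/
def Box.face (n : ℕ) (i : Fin (n + 1)) (ε : Bool) : (⟨n⟩ : Box) ⟶ ⟨n + 1⟩ :=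
  ⟨boxFace n i ε, .face n i ε⟩

/-- The category `Box / X` of a semicubical set `X`: objects are pairs `(n, σ)`, `σ ∈ Xₙ`. -/
structure BoxOver (X : Boxᵒᵖ ⥤ Type u) where
  dim : ℕ
  cell : X.obj (op ⟨dim⟩)

/-- Morphisms `σ → τ` in `Box / X`: morphisms `α` of the box category with `X(α)(τ) = σ`. -/
@[ext]
structure BoxOver.Hom {X : Boxᵒᵖ ⥤ Type u} (σ τ : BoxOver X) where
  map : (⟨σ.dim⟩ : Box) ⟶ ⟨τ.dim⟩
  map_cell : X.map map.op τ.cell = σ.cell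

instance (X : Boxᵒᵖ ⥤ Type u) : Category (BoxOver X) where
  Hom := BoxOver.Hom
  id σ := ⟨𝟙 _, by simp⟩
  comp α β := ⟨α.map ≫ β.map, by simp [α.map_cell, β.map_cell]⟩

section CubicalHomology

variable (X : Boxᵒᵖ ⥤ Type u)

/-- The face `∂ᵢ^{n+1,ε} σ = X(δᵢ^{n+1,ε})(σ)`. -/
def cellFace {n : ℕ} (i : Fin (n + 1)) (ε : Bool) (σ : X.obj (op ⟨n + 1⟩)) : X.obj (op ⟨n⟩) :=
  X.map (Box.face n i ε).op σ

/-- The morphism `∂ᵢ^{n+1,ε} σ → σ` of `Box / X` given by `δᵢ^{n+1,ε}`. -/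
def faceOver {n : ℕ} (i : Fin (n + 1)) (ε : Bool) (σ : X.obj (op ⟨n + 1⟩)) :
    (⟨n, cellFace X i ε σ⟩ : BoxOver X) ⟶ ⟨n + 1, σ⟩ :=
  ⟨Box.face n i ε, rfl⟩

variable {X}
variable (F : (BoxOver X)ᵒᵖ ⥤ AddCommGrpCat.{w})

/-- `Cₙ(X, F) = ⨁_{σ ∈ Xₙ} F(σ)`. -/
noncomputable def cubicalChains (n : ℕ) : AddCommGrpCat.{max u w} :=
  abSum fun σ : X.obj (op ⟨n⟩) => F.obj (op ⟨n, σ⟩)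

/-- `dᵢ^{n+1,ε} : Cₙ₊₁(X, F) → Cₙ(X, F)`. -/
noncomputable def cubicalFace (n : ℕ) (i : Fin (n + 1)) (ε : Bool) :
    cubicalChains F (n + 1) ⟶ cubicalChains F n :=
  abSumMap (fun σ => cellFace X i ε σ) (fun σ => F.map (faceOver X i ε σ).op)

/-- The differential `∑_{i=1}^{n+1} (-1)ⁱ (dᵢ^{n+1,1} - dᵢ^{n+1,0})`; the index `i : Fin (n + 1)`
starts from `0`, whence the exponent `i + 1`. -/
noncomputable def cubicalD (n : ℕ) : cubicalChains F (n + 1) ⟶ cubicalChains F n :=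
  ∑ i : Fin (n + 1), (-1 : ℤ) ^ (i.val + 1) • (cubicalFace F n i true - cubicalFace F n i false)

theorem abSumOf_cell_eq {n : ℕ} {τ : BoxOver X} {ρ ρ' : X.obj (op ⟨n⟩)}
    (p : (⟨n, ρ⟩ : BoxOver X) ⟶ τ) (q : (⟨n, ρ'⟩ : BoxOver X) ⟶ τ) (h : p.map = q.map)
    (a : F.obj (op τ)) :
    abSumOf (fun σ : X.obj (op ⟨n⟩) => F.obj (op ⟨n, σ⟩)) ρ (F.map p.op a) =
      abSumOf (fun σ : X.obj (op ⟨n⟩) => F.obj (op ⟨n, σ⟩)) ρ' (F.map q.op a) := by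
  have e : ρ = ρ' := by
    have h1 := p.map_cell
    have h2 := q.map_cell
    rw [h] at h1
    exact h1.symm.trans h2
  subst e
  have : p = q := BoxOver.Hom.ext h
  rw [this]

theorem Box.face_comp_face {n : ℕ} (i j : Fin (n + 1)) (hij : i ≤ j) (α β : Bool) :
    Box.face n i α ≫ Box.face (n + 1) j.succ β =
      Box.face n j β ≫ Box.face (n + 1) i.castSucc α := by
  have hA : j.succ.succAbove i = i.castSucc :=
    Fin.succAbove_of_castSucc_lt _ _ (Fin.castSucc_lt_succ_iff.2 hij)
  have hB : i.castSucc.succAbove j = j.succ :=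
    Fin.succAbove_of_le_castSucc _ _ (Fin.castSucc_le_castSucc_iff.2 hij)
  have hC : ∀ k : Fin n, j.succ.succAbove (i.succAbove k) = i.castSucc.succAbove (j.succAbove k) := by
    intro k
    ext
    simp only [Fin.succAbove, Fin.lt_def, Fin.le_def] at *
    split_ifs <;> simp at * <;> omega
  refine Box.Hom.ext (OrderHom.ext _ _ (funext fun x => ?_))
  change (j.succ.insertNth β (i.insertNth α x : Fin (n + 1) → Bool) : Fin (n + 2) → Bool) =
    (i.castSucc.insertNth α (j.insertNth β x : Fin (n + 1) → Bool) : Fin (n + 2) → Bool)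
  funext k
  induction k using Fin.succAboveCases i.castSucc with
  | x => rw [Fin.insertNth_apply_same, ← hA, Fin.insertNth_apply_succAbove,
      Fin.insertNth_apply_same]
  | p k =>
    rw [Fin.insertNth_apply_succAbove]
    induction k using Fin.succAboveCases j with
    | x => rw [hB, Fin.insertNth_apply_same, Fin.insertNth_apply_same]
    | p k => rw [← hC, Fin.insertNth_apply_succAbove, Fin.insertNth_apply_succAbove,
        Fin.insertNth_apply_succAbove]

theorem cubicalFace_comp {n : ℕ} (i j : Fin (n + 1)) (hij : i ≤ j) (α β : Bool) :
    cubicalFace F (n + 1) j.succ β ≫ cubicalFace F n i α =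
      cubicalFace F (n + 1) i.castSucc α ≫ cubicalFace F n j β := by
  refine (abSumMap_comp _ _ _ _).trans (Eq.trans ?_ (abSumMap_comp _ _ _ _).symm)
  refine abSumMap_ext _ _ _ _ fun σ a => ?_
  have key := abSumOf_cell_eq F (faceOver X i α _ ≫ faceOver X j.succ β σ)
    (faceOver X j β _ ≫ faceOver X i.castSucc α σ) (Box.face_comp_face i j hij α β) a
  rw [op_comp, op_comp, F.map_comp, F.map_comp] at key
  exact key

theorem cubicalD_comp (n : ℕ) : cubicalD F (n + 1) ≫ cubicalD F n = 0 := by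
  let D : ∀ n (_ : Fin (n + 1)), cubicalChains F (n + 1) ⟶ cubicalChains F n :=
    fun n i => cubicalFace F n i true - cubicalFace F n i false
  have hD : ∀ i j : Fin (n + 1), i ≤ j →
      D (n + 1) j.succ ≫ D n i = D (n + 1) i.castSucc ≫ D n j := by
    intro i j hij
    simp only [D, Preadditive.sub_comp, Preadditive.comp_sub, cubicalFace_comp F i j hij]
    abel
  change (∑ j : Fin (n + 2), (-1 : ℤ) ^ (j.val + 1) • D (n + 1) j) ≫
    (∑ i : Fin (n + 1), (-1 : ℤ) ^ (i.val + 1) • D n i) = 0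
  simp only [Preadditive.comp_sum, Preadditive.sum_comp,
    Preadditive.zsmul_comp, Preadditive.comp_zsmul, Finset.smul_sum, smul_smul]
  rw [← Finset.sum_product']
  let P := Fin (n + 1) × Fin (n + 2)
  let S : Finset P := {ij : P | (ij.2 : ℕ) ≤ (ij.1 : ℕ)}
  rw [Finset.univ_product_univ, ← Finset.sum_add_sum_compl S, ← eq_neg_iff_add_eq_zero,
    ← Finset.sum_neg_distrib]
  refine Finset.sum_bij
    (fun (ij : P) hij => ((Fin.castLT ij.2
      (lt_of_le_of_lt (Finset.mem_filter.mp hij).right (Fin.is_lt ij.1)), ij.1.succ) : P))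
    ?_ ?_ ?_ ?_
  · intro ij hij
    simp_rw [S, Finset.compl_filter, Finset.mem_filter_univ, Fin.val_succ,
      Fin.val_castLT] at hij ⊢
    omega
  · rintro ⟨i, j⟩ hij ⟨i', j'⟩ hij' h
    obtain ⟨h1, h2⟩ := Prod.mk.inj h
    have h1' := congrArg Fin.val h1
    have h2' := congrArg Fin.val h2
    refine Prod.ext (Fin.ext ?_) (Fin.ext ?_)
    · exact Nat.succ.inj h2'
    · exact h1'
  · rintro ⟨i', j'⟩ hij'
    simp_rw [S, Finset.compl_filter, Finset.mem_filter_univ, not_le] at hij'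
    refine ⟨(j'.pred <| ?_, Fin.castSucc i'), ?_, ?_⟩
    · rintro rfl
      simp only [Fin.val_zero, not_lt_zero] at hij'
    · simpa [S] using Nat.le_sub_one_of_lt hij'
    · simp only [Fin.castLT_castSucc, Fin.succ_pred]
  · rintro ⟨i, j⟩ hij
    have hij' : (j : ℕ) ≤ (i : ℕ) := (Finset.mem_filter.mp hij).right
    dsimp only
    rw [← neg_smul, hD _ _ (by simpa [Fin.le_def] using hij'), Fin.castSucc_castLT]
    congr 1
    simp only [Fin.val_castLT, Fin.val_succ, pow_add, pow_one]
    ring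

end CubicalHomology

/-- The homomorphisms `Cₙ(X, F) → Cₙ(X, G)` induced by a natural transformation `F → G`. -/
noncomputable def cubicalChainsMap {X : Boxᵒᵖ ⥤ Type u} {F G : (BoxOver X)ᵒᵖ ⥤ AddCommGrpCat.{w}}
    (η : F ⟶ G) (n : ℕ) : cubicalChains F n ⟶ cubicalChains G n :=
  abSumMap (fun σ => σ) (fun σ => η.app (op ⟨n, σ⟩))

theorem cubicalChainsMap_comp_d {X : Boxᵒᵖ ⥤ Type u} {F G : (BoxOver X)ᵒᵖ ⥤ AddCommGrpCat.{w}}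
    (η : F ⟶ G) (n : ℕ) :
    cubicalChainsMap η (n + 1) ≫ cubicalD G n = cubicalD F n ≫ cubicalChainsMap η n := by
  have key : ∀ (i : Fin (n + 1)) (ε : Bool),
      cubicalChainsMap η (n + 1) ≫ cubicalFace G n i ε =
        cubicalFace F n i ε ≫ cubicalChainsMap η n := by
    intro i ε
    refine (abSumMap_comp _ _ _ _).trans (Eq.trans ?_ (abSumMap_comp _ _ _ _).symm)
    exact congrArg (abSumMap _) (funext fun σ => (η.naturality (faceOver X i ε σ).op).symm)
  simp only [cubicalD, Preadditive.comp_sum, Preadditive.sum_comp, Preadditive.zsmul_comp,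
    Preadditive.comp_zsmul, Preadditive.sub_comp, Preadditive.comp_sub, key]

/-- The chain complex `C_⋄(X, F)` as a functor of the homological system `F`. -/
noncomputable def cubicalComplex (X : Boxᵒᵖ ⥤ Type u) :
    ((BoxOver X)ᵒᵖ ⥤ AddCommGrpCat.{w}) ⥤ ChainComplex AddCommGrpCat.{max u w} ℕ where
  obj F := ChainComplex.of (cubicalChains F) (cubicalD F) (cubicalD_comp F)
  map {F G} η := ChainComplex.ofHom (cubicalChainsMap η) (fun n => by
    refine Eq.trans ?_ ((cubicalChainsMap_comp_d η n).trans ?_)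
    · exact congrArg (cubicalChainsMap η (n + 1) ≫ ·)
        (ChainComplex.of_d (cubicalChains G) (cubicalD G) n)
    · exact congrArg (· ≫ cubicalChainsMap η n)
        (ChainComplex.of_d (cubicalChains F) (cubicalD F) n).symm)
  map_id F := HomologicalComplex.Hom.ext (funext fun _ => abSumMap_id _)
  map_comp η θ := by
    refine HomologicalComplex.Hom.ext (funext fun n => ?_)
    exact (abSumMap_comp (fun σ : X.obj (op ⟨n⟩) => σ) (fun σ => η.app (op ⟨n, σ⟩))
      (fun σ => σ) (fun σ => θ.app (op ⟨n, σ⟩))).symm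

/-- `Hₙ(X, F)` as a functor of the homological system `F`. -/
noncomputable def cubicalHomology (X : Boxᵒᵖ ⥤ Type u) (n : ℕ) :
    ((BoxOver X)ᵒᵖ ⥤ AddCommGrpCat.{w}) ⥤ AddCommGrpCat.{max u w} :=
  cubicalComplex X ⋙ HomologicalComplex.homologyFunctor _ _ n

/-! ### Trace monoids and their factorization categories -/

/-- The trace monoid `M(E, I)`: the free monoid on `E` modulo the congruence generated by
`ab = ba` for `(a, b) ∈ I`. -/
abbrev TraceMonoid {E : Type u} (I : E → E → Prop) : Type u :=
  PresentedMonoid fun x y : FreeMonoid E =>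
    ∃ a b, I a b ∧ x = FreeMonoid.of a * FreeMonoid.of b ∧ y = FreeMonoid.of b * FreeMonoid.of a

/-- A generator `a ∈ E` as an element of `M(E, I)`. -/
def TraceMonoid.of {E : Type u} (I : E → E → Prop) (a : E) : TraceMonoid I :=
  PresentedMonoid.of _ a

theorem TraceMonoid.of_commute {E : Type u} {I : E → E → Prop} {a b : E} (h : I a b) :
    Commute (TraceMonoid.of I a) (TraceMonoid.of I b) :=
  Quotient.sound (ConGen.Rel.of _ _ ⟨a, b, h, rfl, rfl⟩)

/-- The objects of the factorization category of a monoid `M` are the elements of `M`. -/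
structure FactCat (M : Type u) where
  val : M

/-- A morphism `α → β` of the factorization category: a pair `(f, g)` with `g α f = β`. -/
@[ext]
structure FactCat.Hom {M : Type u} [Monoid M] (α β : FactCat M) where
  f : M
  g : M
  mul_eq : g * α.val * f = β.val

instance (M : Type u) [Monoid M] : Category (FactCat M) where
  Hom := FactCat.Hom
  id _ := ⟨1, 1, by simp⟩
  comp p q := ⟨p.f * q.f, q.g * p.g, by rw [← q.mul_eq, ← p.mul_eq]; simp only [mul_assoc]⟩
  id_comp p := FactCat.Hom.ext (one_mul _) (mul_one _)
  comp_id p := FactCat.Hom.ext (mul_one _) (one_mul _)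
  assoc p q r := FactCat.Hom.ext (mul_assoc _ _ _) (mul_assoc _ _ _).symm

/-! ### The coordinates on which a morphism of the box category is not constant -/

theorem IsBoxMap.exists_emb {m n : ℕ} {φ : (Fin m → Bool) →o (Fin n → Bool)} (h : IsBoxMap φ) :
    ∃ ι : Fin m ↪o Fin n, (∀ x k, φ x (ι k) = x k) ∧
      ∀ j, j ∉ Set.range ι → ∀ x y, φ x j = φ y j := by
  induction h with
  | id n => exact ⟨RelEmbedding.refl _, fun _ _ => rfl, fun j hj => (hj ⟨j, rfl⟩).elim⟩
  | face n i ε =>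
    refine ⟨i.succAboveOrderEmb, fun x k => ?_, fun j hj x y => ?_⟩
    · exact Fin.insertNth_apply_succAbove (α := fun _ => Bool) i ε x k
    · have : j = i := by
        by_contra hne
        obtain ⟨k, hk⟩ := Fin.exists_succAbove_eq hne
        exact hj ⟨k, hk⟩
      subst this
      exact (Fin.insertNth_apply_same (α := fun _ => Bool) j ε x).trans
        (Fin.insertNth_apply_same (α := fun _ => Bool) j ε y).symm
  | comp _ _ ih₁ ih₂ =>
    rename_i ψ φ _ _
    obtain ⟨ι₁, h₁, h₁'⟩ := ih₁
    obtain ⟨ι₂, h₂, h₂'⟩ := ih₂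
    refine ⟨ι₂.trans ι₁, fun x k => ?_, fun j hj x y => ?_⟩
    · exact (h₁ (φ x) (ι₂ k)).trans (h₂ x k)
    · by_cases hj₁ : j ∈ Set.range ι₁
      · obtain ⟨k, rfl⟩ := hj₁
        have hk : k ∉ Set.range ι₂ := by
          rintro ⟨l, rfl⟩
          exact hj ⟨l, rfl⟩
        exact (h₁ (φ x) k).trans ((h₂' k hk x y).trans (h₁ (φ y) k).symm)
      · exact h₁' j hj₁ (φ x) (φ y)

/-- The increasing enumeration of the coordinates of `{0,1}ⁿ` on which `φ : {0,1}ᵐ → {0,1}ⁿ`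
is not constant. -/
noncomputable def Box.Hom.emb {m n : Box} (φ : Box.Hom m n) : Fin m.dim ↪o Fin n.dim :=
  φ.isBoxMap.exists_emb.choose

theorem Box.Hom.map_emb {m n : Box} (φ : Box.Hom m n) (x : Fin m.dim → Bool) (k : Fin m.dim) :
    φ.map x (φ.emb k) = x k :=
  φ.isBoxMap.exists_emb.choose_spec.1 x k

theorem Box.Hom.map_of_notMem {m n : Box} (φ : Box.Hom m n) {j : Fin n.dim}
    (hj : j ∉ Set.range φ.emb) (x y : Fin m.dim → Bool) : φ.map x j = φ.map y j :=
  φ.isBoxMap.exists_emb.choose_spec.2 j hj x y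

theorem Box.Hom.mem_range_emb {m n : Box} (φ : Box.Hom m n) (j : Fin n.dim) :
    j ∈ Set.range φ.emb ↔ φ.map ⊥ j = false ∧ φ.map ⊤ j = true := by
  constructor
  · rintro ⟨k, rfl⟩
    simp [φ.map_emb]
  · rintro ⟨h₀, h₁⟩
    by_contra hj
    rw [φ.map_of_notMem hj ⊥ ⊤, h₁] at h₀
    exact absurd h₀ (by simp)

theorem Box.Hom.eq_emb {m n : Box} (φ : Box.Hom m n) (ι : Fin m.dim ↪o Fin n.dim)
    (h : ∀ x k, φ.map x (ι k) = x k) : φ.emb = ι := by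
  refine DFunLike.coe_injective ((StrictMono.range_inj φ.emb.strictMono ι.strictMono).1 ?_)
  have hsub : Set.range ι ⊆ Set.range φ.emb := by
    rintro _ ⟨k, rfl⟩
    rw [φ.mem_range_emb, h, h]
    simp
  have h1 : (Set.range φ.emb).ncard = m.dim := by
    rw [← Set.image_univ, Set.ncard_image_of_injective _ φ.emb.injective, Set.ncard_univ]; simp
  have h2 : (Set.range ι).ncard = m.dim := by
    rw [← Set.image_univ, Set.ncard_image_of_injective _ ι.injective, Set.ncard_univ]; simp
  exact (Set.eq_of_subset_of_ncard_le hsub (by rw [h1, h2]) (Set.toFinite _)).symm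

theorem Box.emb_id (n : Box) : Box.Hom.emb (𝟙 n : n ⟶ n) = RelEmbedding.refl _ :=
  Box.Hom.eq_emb _ _ fun _ _ => rfl

theorem Box.emb_comp {l m n : Box} (φ : l ⟶ m) (ψ : m ⟶ n) :
    Box.Hom.emb (φ ≫ ψ) = (Box.Hom.emb φ).trans (Box.Hom.emb ψ) :=
  Box.Hom.eq_emb _ _ fun x k =>
    (Box.Hom.map_emb ψ (Box.Hom.map φ x) (Box.Hom.emb φ k)).trans (Box.Hom.map_emb φ x k)

theorem Box.emb_face (n : ℕ) (i : Fin (n + 1)) (ε : Bool) :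
    Box.Hom.emb (Box.face n i ε) = i.succAboveOrderEmb :=
  Box.Hom.eq_emb _ _ fun x k => Fin.insertNth_apply_succAbove (α := fun _ => Bool) i ε x k

/-! ### The generalized torus -/

section Torus

variable {E : Type u} [LinearOrder E] (I : E → E → Prop)

/-- `Tₙ(E, I)`: the `n`-tuples `a₁ < ⋯ < aₙ` with `(aᵢ, aⱼ) ∈ I` for all `i < j`. -/
def TorusCell (n : ℕ) : Type u :=
  {a : Fin n → E // ∀ i j, i < j → a i < a j ∧ I (a i) (a j)}

/-- The generalized torus `T(E, I)`.  A morphism `φ : {0,1}ᵐ → {0,1}ⁿ` of the box category sends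
`(a₁, …, aₙ)` to the subsequence formed by the coordinates on which `φ` is not constant; for
`φ = δᵢ^{n,ε}` this deletes `aᵢ`. -/
noncomputable def torus : Boxᵒᵖ ⥤ Type u where
  obj n := TorusCell I n.unop.dim
  map φ := ↾fun a => ⟨fun k => a.1 (Box.Hom.emb φ.unop k),
    fun i j hij => a.2 _ _ ((Box.Hom.emb φ.unop).strictMono hij)⟩
  map_id n := by
    ext a
    refine Subtype.ext (funext fun k => ?_)
    exact congrArg a.1 (congrArg (fun e => e k) (Box.emb_id n.unop))
  map_comp φ ψ := by
    ext a
    refine Subtype.ext (funext fun k => ?_)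
    exact congrArg a.1 (congrArg (fun e => e k) (Box.emb_comp ψ.unop φ.unop))

/-- `∂ᵢ^{n+1,ε} (a₁, …, aₙ₊₁) = (a₁, …, aᵢ₋₁, aᵢ₊₁, …, aₙ₊₁)`. -/
theorem torus_face {n : ℕ} (i : Fin (n + 1)) (ε : Bool) (a : TorusCell I (n + 1)) :
    (cellFace (torus I) i ε a).1 = fun k => a.1 (i.succAbove k) :=
  funext fun k => congrArg a.1 (congrArg (fun e => e k) (Box.emb_face n i ε))

end Torus

/-! ### Ordered products in a monoid -/

section OrderedProducts

variable {M : Type u} [Monoid M]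

/-- The product `u₁ u₂ ⋯ uₙ`. -/
def orderedProd {n : ℕ} (u : Fin n → M) : M := (List.ofFn u).prod

theorem orderedProd_mul {n : ℕ} (u v : Fin n → M)
    (h : ∀ i j, i < j → Commute (v i) (u j)) :
    orderedProd (fun i => u i * v i) = orderedProd u * orderedProd v := by
  induction n with
  | zero => simp [orderedProd]
  | succ n ih =>
    have ih' := ih (fun i => u i.succ) (fun i => v i.succ)
      fun i j hij => h _ _ (Fin.succ_lt_succ_iff.2 hij)
    have hc : Commute (v 0) (orderedProd fun i => u i.succ) := by
      refine Commute.list_prod_right _ _ fun x hx => ?_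
      obtain ⟨j, rfl⟩ := List.mem_ofFn.1 hx
      exact h _ _ (Fin.succ_pos j)
    simp only [orderedProd] at ih' hc ⊢
    rw [List.ofFn_succ, List.ofFn_succ, List.ofFn_succ, List.prod_cons, List.prod_cons,
      List.prod_cons, ih', mul_assoc, ← mul_assoc (v 0), hc.eq]
    simp only [mul_assoc]

theorem orderedProd_comp_emb {m n : ℕ} (e : Fin m ↪o Fin n) (u : Fin n → M)
    (h : ∀ j, j ∉ Set.range e → u j = 1) :
    orderedProd (fun k => u (e k)) = orderedProd u := by
  classical
  have key : ∀ l : List (Fin n),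
      ((l.filter fun j => j ∈ Set.range e).map u).prod = (l.map u).prod := by
    intro l
    induction l with
    | nil => rfl
    | cons j l ih =>
      by_cases hj : j ∈ Set.range e
      · rw [List.filter_cons_of_pos (by simpa using hj)]
        simp only [List.map_cons, List.prod_cons, ih]
      · rw [List.filter_cons_of_neg (by simpa using hj)]
        simp only [List.map_cons, List.prod_cons, ih, h j hj, one_mul]
  have hl : (List.finRange n).filter (fun j => j ∈ Set.range e) = (List.finRange m).map e := by
    refine List.Perm.eq_of_pairwise' (r := (· < ·)) ?_ ?_ ?_
    · exact (List.pairwise_lt_finRange n).filter _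
    · exact (List.pairwise_lt_finRange m).map _ fun _ _ hij => e.strictMono hij
    · refine (List.perm_ext_iff_of_nodup ((List.nodup_finRange n).filter _)
        ((List.nodup_finRange m).map e.injective)).2 fun j => ?_
      simp
  simp only [orderedProd, List.ofFn_eq_map]
  rw [← key, hl, List.map_map]
  rfl

theorem orderedProd_ite_eq {n : ℕ} (i : Fin n) (x : Fin n → M) (p : Fin n → Prop)
    [DecidablePred p] (hp : ∀ j, p j ↔ j = i) :
    orderedProd (fun j => if p j then x j else 1) = x i := by
  let e : Fin 1 ↪o Fin n := OrderEmbedding.ofStrictMono (fun _ => i) fun a b hab =>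
    absurd hab (by simp [Subsingleton.elim a b])
  rw [← orderedProd_comp_emb e]
  · have : ∀ k, e k = i := fun _ => rfl
    simp [orderedProd, this, hp]
  · intro j hj
    rw [if_neg]
    rintro h
    exact hj ⟨0, ((hp j).1 h).symm⟩

end OrderedProducts

/-! ### The functor from `Box / T(E, I)` to the factorization category -/

section TorusToFact

variable {E : Type u} [LinearOrder E] {I : E → E → Prop}

/-- The ordered product of those `aⱼ` for which `p j` holds. -/
def partialProd {n : ℕ} (a : TorusCell I n) (p : Fin n → Prop) [DecidablePred p] :
    TraceMonoid I :=
  orderedProd fun j => if p j then TraceMonoid.of I (a.1 j) else 1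

theorem partialProd_or {n : ℕ} (a : TorusCell I n) (p q r : Fin n → Prop) [DecidablePred p]
    [DecidablePred q] [DecidablePred r] (hr : ∀ j, r j ↔ p j ∨ q j) (hpq : ∀ j, p j → ¬ q j) :
    partialProd a r = partialProd a p * partialProd a q := by
  unfold partialProd
  rw [← orderedProd_mul]
  · congr 1
    funext j
    by_cases hp : p j
    · simp [hp, hpq j hp, hr]
    · simp [hp, hr]
  · intro i j hij
    have hc := TraceMonoid.of_commute (a.2 i j hij).2
    split_ifs
    · exact hc
    · exact Commute.one_right _
    · exact Commute.one_left _
    · exact Commute.one_left _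

theorem partialProd_emb {m n : Box} (φ : m ⟶ n) (b : TorusCell I m.dim) (a : TorusCell I n.dim)
    (h : ∀ k, b.1 k = a.1 (Box.Hom.emb φ k)) (p : Fin m.dim → Prop) (q : Fin n.dim → Prop)
    [DecidablePred p] [DecidablePred q] (h₁ : ∀ k, q (Box.Hom.emb φ k) ↔ p k)
    (h₂ : ∀ j, q j → j ∈ Set.range (Box.Hom.emb φ)) :
    partialProd b p = partialProd a q := by
  unfold partialProd
  rw [← orderedProd_comp_emb (Box.Hom.emb φ) (fun j => if q j then TraceMonoid.of I (a.1 j) else 1)]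
  · congr 1
    funext k
    simp [h, h₁]
  · intro j hj
    exact if_neg fun hq => hj (h₂ j hq)

theorem BoxOver.Hom.cell_eq {σ τ : BoxOver (torus I)} (α : σ ⟶ τ) (k : Fin σ.dim) :
    σ.cell.1 k = τ.cell.1 (Box.Hom.emb α.map k) := by
  rw [← α.map_cell]
  rfl

variable (I) in
/-- The functor `Box / T(E, I) → Fact(M(E, I))` with `(a₁, …, aₙ) ↦ a₁ ⋯ aₙ`.  A morphism `α` over
`(a₁, …, aₙ)` is sent to the pair `(f, g)`, where `f` is the product of the `aⱼ` for which the
`j`-th coordinate of `α` is constantly `0`, and `g` is the product of those for which it is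
constantly `1`; for `α = δᵢ^{n,ε}` this is `(aᵢ^{1-ε}, aᵢ^ε)`. -/
noncomputable def torusToFact : BoxOver (torus I) ⥤ FactCat (TraceMonoid I) where
  obj σ := ⟨orderedProd fun k => TraceMonoid.of I (σ.cell.1 k)⟩
  map {σ τ} α :=
    { f := partialProd τ.cell fun j => Box.Hom.map α.map ⊤ j = false
      g := partialProd τ.cell fun j => Box.Hom.map α.map ⊥ j = true
      mul_eq := by
        have hmono : ∀ j, Box.Hom.map α.map ⊥ j ≤ Box.Hom.map α.map ⊤ j :=
          fun j => (Box.Hom.map α.map).monotone bot_le j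
        have h₁ : (orderedProd fun k => TraceMonoid.of I (σ.cell.1 k)) =
            partialProd τ.cell fun j =>
              Box.Hom.map α.map ⊥ j = false ∧ Box.Hom.map α.map ⊤ j = true := by
          rw [← partialProd_emb α.map σ.cell τ.cell α.cell_eq (fun _ => True)]
          · simp [partialProd]
          · intro k
            simpa using (Box.Hom.mem_range_emb α.map _).1 ⟨k, rfl⟩
          · exact fun j hj => (Box.Hom.mem_range_emb α.map j).2 hj
        have h₂ : (orderedProd fun k => TraceMonoid.of I (τ.cell.1 k)) =
            partialProd τ.cell fun _ => True := by
          simp [partialProd]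
        change _ * (orderedProd fun k => TraceMonoid.of I (σ.cell.1 k)) * _ =
          (orderedProd fun k => TraceMonoid.of I (τ.cell.1 k))
        rw [h₁, h₂, ← partialProd_or τ.cell _ _ (fun j => Box.Hom.map α.map ⊤ j = true),
          ← partialProd_or τ.cell _ _ (fun _ => True)]
        · intro j
          cases Box.Hom.map α.map ⊤ j <;> simp
        · intro j
          cases Box.Hom.map α.map ⊤ j <;> simp
        · intro j
          have := hmono j
          revert this
          cases Box.Hom.map α.map ⊤ j <;> cases Box.Hom.map α.map ⊥ j <;> simp
        · intro j
          cases Box.Hom.map α.map ⊥ j <;> simp }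
  map_id σ := by
    refine FactCat.Hom.ext ?_ ?_
    · change orderedProd (fun j => if (⊤ : Fin σ.dim → Bool) j = false then _ else _) = 1
      simp [orderedProd]
    · change orderedProd (fun j => if (⊥ : Fin σ.dim → Bool) j = true then _ else _) = 1
      simp [orderedProd]
  map_comp {ρ σ τ} α β := by
    have hmono : ∀ (x : Fin σ.dim → Bool) j, Box.Hom.map β.map ⊥ j ≤ Box.Hom.map β.map x j ∧
        Box.Hom.map β.map x j ≤ Box.Hom.map β.map ⊤ j :=
      fun x j => ⟨(Box.Hom.map β.map).monotone bot_le j, (Box.Hom.map β.map).monotone le_top j⟩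
    have hemb : ∀ (x : Fin σ.dim → Bool) k,
        Box.Hom.map β.map x (Box.Hom.emb β.map k) = x k := Box.Hom.map_emb β.map
    have hrange : ∀ (x : Fin σ.dim → Bool) j,
        Box.Hom.map β.map x j ≠ Box.Hom.map β.map ⊤ j ∨
          Box.Hom.map β.map x j ≠ Box.Hom.map β.map ⊥ j → j ∈ Set.range (Box.Hom.emb β.map) := by
      intro x j h
      by_contra hj
      rcases h with h | h
      · exact h (Box.Hom.map_of_notMem β.map hj _ _)
      · exact h (Box.Hom.map_of_notMem β.map hj _ _)
    refine FactCat.Hom.ext ?_ ?_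
    · change partialProd τ.cell (fun j =>
          Box.Hom.map β.map (Box.Hom.map α.map ⊤) j = false) =
        partialProd σ.cell (fun j => Box.Hom.map α.map ⊤ j = false) *
          partialProd τ.cell (fun j => Box.Hom.map β.map ⊤ j = false)
      rw [partialProd_emb β.map σ.cell τ.cell β.cell_eq _
        (fun j => Box.Hom.map β.map ⊤ j = true ∧
          Box.Hom.map β.map (Box.Hom.map α.map ⊤) j = false)]
      · refine partialProd_or τ.cell _ _ _ (fun j => ?_) (fun j => ?_)
        · have := hmono (Box.Hom.map α.map ⊤) j
          revert this
          cases Box.Hom.map β.map ⊤ j <;>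
            cases Box.Hom.map β.map (Box.Hom.map α.map ⊤) j <;> simp
        · rintro ⟨h, -⟩
          simp [h]
      · intro k
        simp [hemb]
      · rintro j ⟨h, h'⟩
        exact hrange (Box.Hom.map α.map ⊤) j (Or.inl (by rw [h, h']; simp))
    · change partialProd τ.cell (fun j =>
          Box.Hom.map β.map (Box.Hom.map α.map ⊥) j = true) =
        partialProd τ.cell (fun j => Box.Hom.map β.map ⊥ j = true) *
          partialProd σ.cell (fun j => Box.Hom.map α.map ⊥ j = true)
      rw [partialProd_emb β.map σ.cell τ.cell β.cell_eq _
        (fun j => Box.Hom.map β.map ⊥ j = false ∧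
          Box.Hom.map β.map (Box.Hom.map α.map ⊥) j = true)]
      · refine partialProd_or τ.cell _ _ _ (fun j => ?_) (fun j => ?_)
        · have := hmono (Box.Hom.map α.map ⊥) j
          revert this
          cases Box.Hom.map β.map ⊥ j <;>
            cases Box.Hom.map β.map (Box.Hom.map α.map ⊥) j <;> simp
        · intro h
          simp [h]
      · intro k
        simp [hemb]
      · rintro j ⟨h, h'⟩
        exact hrange (Box.Hom.map α.map ⊥) j (Or.inr (by rw [h, h']; simp))

/-- The functor sends `∂ᵢ^{n+1,ε} (a₁, …, aₙ₊₁) → (a₁, …, aₙ₊₁)` to `(aᵢ^{1-ε}, aᵢ^ε)`. -/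
theorem torusToFact_face {n : ℕ} (i : Fin (n + 1)) (ε : Bool) (a : TorusCell I (n + 1)) :
    FactCat.Hom.f ((torusToFact I).map (faceOver (torus I) i ε a)) =
        TraceMonoid.of I (a.1 i) ^ (1 - ε.toNat) ∧
      FactCat.Hom.g ((torusToFact I).map (faceOver (torus I) i ε a)) =
        TraceMonoid.of I (a.1 i) ^ ε.toNat := by
  have hs : ∀ (x : Fin n → Bool) (b : Bool), (∀ k, x k ≠ b) → ∀ j,
      (i.insertNth ε x : Fin (n + 1) → Bool) j = b ↔ j = i ∧ ε = b := by
    intro x b hx j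
    induction j using Fin.succAboveCases i with
    | x => simp
    | p k => simp [hx k, Fin.succAbove_ne]
  have hf := hs ⊤ false (by simp)
  have hg := hs ⊥ true (by simp)
  constructor
  · change orderedProd (fun j => if (i.insertNth ε ⊤ : Fin (n + 1) → Bool) j = false then
      TraceMonoid.of I (a.1 j) else 1) = _
    cases ε
    · rw [orderedProd_ite_eq i (fun j => TraceMonoid.of I (a.1 j))
        (fun j => (i.insertNth false ⊤ : Fin (n + 1) → Bool) j = false)
        (fun j => by rw [hf]; simp)]
      simp
    · simp [hf, orderedProd]
  · change orderedProd (fun j => if (i.insertNth ε ⊥ : Fin (n + 1) → Bool) j = true then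
      TraceMonoid.of I (a.1 j) else 1) = _
    cases ε
    · simp [hg, orderedProd]
    · rw [orderedProd_ite_eq i (fun j => TraceMonoid.of I (a.1 j))
        (fun j => (i.insertNth true ⊥ : Fin (n + 1) → Bool) j = true)
        (fun j => by rw [hg]; simp)]
      simp

end TorusToFact

/-!
Write `C` for the factorization category of the trace monoid. Both homology theories are of the
form `F ↦ H(F ⊗ K)`, where `K` is a chain complex of functors `C ⥤ Ab` of the shape
`⨁ i, ℤ[C(cᵢ, -)]`, and `F ⊗ ⨁ i, ℤ[C(cᵢ, -)] = ⨁ i, F(cᵢ)`. For the homology of `Cᵒᵖ`, `K` is the complex of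
chains of morphisms (`barComplex`); for the cubical homology it is the complex of the cells of the
torus (`cubicalFreeComplex`). Sums of representable functors are projective, so if both complexes
resolve the constant functor `ℤ`, they are homotopy equivalent. By the Yoneda lemma the maps and
homotopies are matrices with entries in `ℤ[C(c, d)]`, and such a matrix acts on `⨁ i, F(cᵢ)`,
naturally in `F`. This is expressed by the category `FreeCat C` of sums of representable functors
with the additive functors `tensorFunctor F` on it (`IsFreeResolution.tensorHomologyIso`). The
functor `F` may take values in a universe smaller than that of `C`, where it is not a quotient of
representable functors; this is why the comparison takes place in `FreeCat C` and not among
functors of `F`.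

Exactness is checked at each object of `C`. For `barComplex` there is an extra degeneracy. The
value at `α` of the complex of the torus is free on the triples `(a, f, g)` with `g a f = α`, for
`a` a product of distinct pairwise commuting letters. Exactness is shown by induction on the
length of `α`. If `α = α' b` for a letter `b`, then `(a, f, g) ↦ (a, f b, g)` embeds the complex
at `α'` as a subcomplex. By a Levi type lemma for trace monoids
(`TraceMonoid.right_division_cases`) the remaining triples are those in which all letters of `f`
are independent of `b` and either `b` is a letter of `a`, or all letters of `a` are independent of
`b` and `b` divides `g` on the right. The pairing of `(a, f, g' b)` with `(a ∪ b, f, g')`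
collapses the complex onto the subcomplex (`TorusChains.homotopy_mem_range`). The case distinction
and the right cancellation law come from the action of the trace monoid on the possible outcomes
of a search for the last letter which is not independent of `b` (`TraceMonoid.EndStatus`).
-/

/-! ### Sums of representable functors -/

/-- A family of objects of a category `C`, indexed by a type. -/
structure ObjFamily (C : Type u) where
  idx : Type u
  obj : idx → C

section SumAt

variable {C : Type u} [Category.{u} C]

/-- The group `⨁ i, F(cᵢ)` attached to a presheaf `F` and a family `c` of objects. -/
noncomputable abbrev sumAt (F : Cᵒᵖ ⥤ AddCommGrpCat.{w}) (X : ObjFamily C) :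
    AddCommGrpCat.{max u w} :=
  abSum fun i : X.idx => F.obj (op (X.obj i))

/-- The homomorphism `⨁ i, F(cᵢ) → ⨁ i, G(cᵢ)` induced by `F → G`. -/
noncomputable abbrev sumAtMap {F G : Cᵒᵖ ⥤ AddCommGrpCat.{w}} (η : F ⟶ G) (X : ObjFamily C) :
    sumAt F X ⟶ sumAt G X :=
  abSumMap (fun i => i) fun i => η.app (op (X.obj i))

variable (C) in
/-- The functor `x ↦ ℤ[C(-, x)]`. -/
noncomputable abbrev freeYoneda : C ⥤ Cᵒᵖ ⥤ AddCommGrpCat.{u} :=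
  yoneda ⋙ (Functor.whiskeringRight _ _ _).obj AddCommGrpCat.free

/-- The functor `⨁ i, ℤ[C(cᵢ, -)]`, written as `x ↦ ⨁ i, ℤ[C(-, x)](cᵢ)`. -/
noncomputable def freeFunctor (X : ObjFamily C) : C ⥤ AddCommGrpCat.{u} where
  obj x := sumAt ((freeYoneda C).obj x) X
  map f := sumAtMap ((freeYoneda C).map f) X
  map_id x := by
    rw [(freeYoneda C).map_id]
    exact abSumMap_id _
  map_comp f g := by
    rw [(freeYoneda C).map_comp]
    exact (abSumMap_comp (fun i => i) _ (fun i => i) _).symm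

/-- The basis element of `⨁ i, ℤ[C(cᵢ, x)]` given by an index `i` and a morphism `cᵢ → x`. -/
noncomputable def freeFunctorOf (X : ObjFamily C) {x : C} (i : X.idx) (m : X.obj i ⟶ x) :
    (freeFunctor X).obj x :=
  abSumOf (fun i => ((freeYoneda C).obj x).obj (op (X.obj i))) i (FreeAbelianGroup.of m)

theorem freeFunctor_map_of (X : ObjFamily C) {x y : C} (i : X.idx) (m : X.obj i ⟶ x)
    (f : x ⟶ y) :
    (freeFunctor X).map f (freeFunctorOf X i m) = freeFunctorOf X i (m ≫ f) := by
  refine (abSumMap_of _ _ _ _).trans ?_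
  refine congrArg (abSumOf _ i) ?_
  exact FreeAbelianGroup.map_of_apply m

/-- The homomorphism from `⨁ i, ℤ[C(cᵢ, x)]` with prescribed values on the basis. -/
noncomputable def freeFunctorLift (X : ObjFamily C) {x : C} {A : Type w} [AddCommGroup A]
    (φ : ∀ i, (X.obj i ⟶ x) → A) : (freeFunctor X).obj x →+ A :=
  open Classical in
  DirectSum.toAddMonoid fun i => (FreeAbelianGroup.lift (φ i) : FreeAbelianGroup _ →+ A)

theorem freeFunctorLift_of (X : ObjFamily C) {x : C} {A : Type w} [AddCommGroup A]
    (φ : ∀ i, (X.obj i ⟶ x) → A) (i : X.idx) (m : X.obj i ⟶ x) :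
    freeFunctorLift X φ (freeFunctorOf X i m) = φ i m := by
  classical
  refine (DirectSum.toAddMonoid_of _ _ _).trans ?_
  exact FreeAbelianGroup.lift_apply_of _ _

theorem freeFunctor_hom_ext (X : ObjFamily C) {x : C} {A : Type w} [AddCommGroup A]
    {f g : (freeFunctor X).obj x →+ A}
    (h : ∀ i m, f (freeFunctorOf X i m) = g (freeFunctorOf X i m)) : f = g := by
  classical
  refine DirectSum.addHom_ext' fun i => ?_
  exact FreeAbelianGroup.lift_ext _ _ fun m => h i m

theorem freeFunctor_ext (X : ObjFamily C) {x : C} {A : AddCommGrpCat.{u}}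
    {f g : (freeFunctor X).obj x ⟶ A}
    (h : ∀ i m, f (freeFunctorOf X i m) = g (freeFunctorOf X i m)) : f = g :=
  AddCommGrpCat.hom_ext (freeFunctor_hom_ext X h)

/-- `freeFunctorLift` as a morphism of the category of abelian groups. -/
noncomputable def freeFunctorHom (X : ObjFamily C) {x : C} {A : AddCommGrpCat.{u}}
    (φ : ∀ i, (X.obj i ⟶ x) → A) : (freeFunctor X).obj x ⟶ A :=
  AddCommGrpCat.ofHom (freeFunctorLift X φ)

theorem freeFunctorHom_of (X : ObjFamily C) {x : C} {A : AddCommGrpCat.{u}}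
    (φ : ∀ i, (X.obj i ⟶ x) → A) (i : X.idx) (m : X.obj i ⟶ x) :
    freeFunctorHom X φ (freeFunctorOf X i m) = φ i m :=
  freeFunctorLift_of X φ i m

/-- The Yoneda lemma: natural transformations out of `⨁ i, ℤ[C(cᵢ, -)]` are families of elements. -/
noncomputable def freeFunctorDesc (X : ObjFamily C) {G : C ⥤ AddCommGrpCat.{u}}
    (a : ∀ i, G.obj (X.obj i)) : freeFunctor X ⟶ G where
  app x := freeFunctorHom X fun i m => G.map m (a i)
  naturality x y f := by
    refine freeFunctor_ext X fun i m => ?_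
    rw [AddCommGrpCat.comp_apply, AddCommGrpCat.comp_apply, freeFunctor_map_of, freeFunctorHom_of,
      freeFunctorHom_of, G.map_comp, AddCommGrpCat.comp_apply]

theorem freeFunctorDesc_of (X : ObjFamily C) {G : C ⥤ AddCommGrpCat.{u}}
    (a : ∀ i, G.obj (X.obj i)) {x : C} (i : X.idx) (m : X.obj i ⟶ x) :
    (freeFunctorDesc X a).app x (freeFunctorOf X i m) = G.map m (a i) :=
  freeFunctorHom_of _ _ _ _

theorem freeFunctor_natTrans_of (X : ObjFamily C) {G : C ⥤ AddCommGrpCat.{u}}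
    (η : freeFunctor X ⟶ G) {x : C} (i : X.idx) (m : X.obj i ⟶ x) :
    η.app x (freeFunctorOf X i m) = G.map m (η.app _ (freeFunctorOf X i (𝟙 _))) := by
  have h := freeFunctor_map_of X i (𝟙 _) m
  rw [Category.id_comp] at h
  rw [← h]
  exact NatTrans.naturality_apply η m _

theorem freeFunctor_natTrans_ext (X : ObjFamily C) {G : C ⥤ AddCommGrpCat.{u}}
    {η θ : freeFunctor X ⟶ G}
    (h : ∀ i, η.app _ (freeFunctorOf X i (𝟙 _)) = θ.app _ (freeFunctorOf X i (𝟙 _))) : η = θ := by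
  refine NatTrans.ext (funext fun x => freeFunctor_ext X fun i m => ?_)
  rw [freeFunctor_natTrans_of, freeFunctor_natTrans_of X θ, h]

instance freeFunctor_projective (X : ObjFamily C) : Projective (freeFunctor X) where
  factors {A B} f e he := by
    have hs : ∀ x, Function.Surjective (e.app x) := fun x =>
      (AddCommGrpCat.epi_iff_surjective _).1 inferInstance
    choose a ha using fun i => hs _ (f.app _ (freeFunctorOf X i (𝟙 _)))
    refine ⟨freeFunctorDesc X a, freeFunctor_natTrans_ext X fun i => ?_⟩
    rw [NatTrans.comp_app, AddCommGrpCat.comp_apply, freeFunctorDesc_of, A.map_id,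
      AddCommGrpCat.id_apply, ha]


/-! ### The tensor product of a presheaf with a sum of representable functors -/

variable (F : Cᵒᵖ ⥤ AddCommGrpCat.{w})

/-- The homomorphism `⨁ i, ℤ[C(cᵢ, x)] → ⨁ i, F(cᵢ)` which sends `(i, m)` to `(i, F(m) a)`, for
`a ∈ F(x)`. -/
noncomputable def freePairing (X : ObjFamily C) {x : C} (a : F.obj (op x)) :
    (freeFunctor X).obj x →+ sumAt F X :=
  freeFunctorLift X fun i m => abSumOf (fun i => F.obj (op (X.obj i))) i (F.map m.op a)

theorem freePairing_of (X : ObjFamily C) {x : C} (a : F.obj (op x)) (i : X.idx)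
    (m : X.obj i ⟶ x) :
    freePairing F X a (freeFunctorOf X i m) =
      abSumOf (fun i => F.obj (op (X.obj i))) i (F.map m.op a) :=
  freeFunctorLift_of _ _ _ _

theorem freePairing_add (X : ObjFamily C) {x : C} (a b : F.obj (op x)) :
    freePairing F X (a + b) = freePairing F X a + freePairing F X b := by
  classical
  refine freeFunctor_hom_ext X fun i m => ?_
  rw [AddMonoidHom.add_apply, freePairing_of, freePairing_of, freePairing_of, map_add]
  exact map_add (DirectSum.of (fun i => F.obj (op (X.obj i))) i) _ _

/-- The pairing is balanced over `C`. -/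
theorem freePairing_map (X : ObjFamily C) {x y : C} (f : x ⟶ y) (a : F.obj (op y))
    (z : (freeFunctor X).obj x) :
    freePairing F X (F.map f.op a) z = freePairing F X a ((freeFunctor X).map f z) := by
  have : freePairing F X (F.map f.op a) =
      (freePairing F X a).comp ((freeFunctor X).map f).hom := by
    refine freeFunctor_hom_ext X fun i m => ?_
    rw [freePairing_of]
    refine Eq.trans ?_ (congrArg (freePairing F X a) (freeFunctor_map_of X i m f).symm)
    rw [freePairing_of, op_comp, F.map_comp, AddCommGrpCat.comp_apply]
  exact DFunLike.congr_fun this z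

/-- The full subcategory of `C ⥤ Ab` of the sums of representable functors, with the families of
objects of `C` as its objects. -/
abbrev FreeCat (C : Type u) [Category.{u} C] :=
  InducedCategory (C ⥤ AddCommGrpCat.{u}) (freeFunctor (C := C))

/-- The homomorphism `⨁ i, F(cᵢ) → ⨁ j, F(dⱼ)` induced by `⨁ i, ℤ[C(cᵢ, -)] → ⨁ j, ℤ[C(dⱼ, -)]`. -/
noncomputable def tensorMap {X Y : ObjFamily C} (η : freeFunctor X ⟶ freeFunctor Y) :
    sumAt F X ⟶ sumAt F Y :=
  open Classical in
  AddCommGrpCat.ofHom (DirectSum.toAddMonoid fun i =>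
    AddMonoidHom.mk' (fun a => freePairing F Y a (η.app _ (freeFunctorOf X i (𝟙 _))))
      fun a b => by rw [freePairing_add]; rfl)

theorem tensorMap_of {X Y : ObjFamily C} (η : freeFunctor X ⟶ freeFunctor Y) (i : X.idx)
    (a : F.obj (op (X.obj i))) :
    tensorMap F η (abSumOf (fun i => F.obj (op (X.obj i))) i a) =
      freePairing F Y a (η.app _ (freeFunctorOf X i (𝟙 _))) := by
  classical
  exact DirectSum.toAddMonoid_of _ _ _

theorem tensorMap_freePairing {X Y : ObjFamily C} (η : freeFunctor X ⟶ freeFunctor Y) {x : C}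
    (a : F.obj (op x)) (z : (freeFunctor X).obj x) :
    tensorMap F η (freePairing F X a z) = freePairing F Y a (η.app x z) := by
  have : (tensorMap F η).hom.comp (freePairing F X a) =
      (freePairing F Y a).comp (η.app x).hom := by
    refine freeFunctor_hom_ext X fun i m => ?_
    refine (congrArg (tensorMap F η) (freePairing_of F X a i m)).trans ?_
    rw [tensorMap_of, freePairing_map]
    exact congrArg (freePairing F Y a) (freeFunctor_natTrans_of X η i m).symm
  exact DFunLike.congr_fun this z

/-- The additive functor `F ⊗ -` on sums of representable functors; on objects it sends
`⨁ i, ℤ[C(cᵢ, -)]` to `⨁ i, F(cᵢ)`. -/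
noncomputable def tensorFunctor : FreeCat C ⥤ AddCommGrpCat.{max u w} where
  obj X := sumAt F X
  map η := tensorMap F η.hom
  map_id X := by
    refine abSum_ext _ _ fun i a => ?_
    rw [tensorMap_of, AddCommGrpCat.id_apply]
    refine (freePairing_of F X a i (𝟙 _)).trans ?_
    rw [op_id, F.map_id, AddCommGrpCat.id_apply]
  map_comp η θ := by
    refine abSum_ext _ _ fun i a => ?_
    rw [AddCommGrpCat.comp_apply, tensorMap_of, tensorMap_of, tensorMap_freePairing]
    rfl

instance : (tensorFunctor F).Additive where
  map_add {X Y η θ} := by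
    refine abSum_ext _ _ fun i a => ?_
    refine (tensorMap_of F _ i a).trans ?_
    refine (map_add (freePairing F Y a) _ _).trans ?_
    exact congrArg₂ (· + ·) (tensorMap_of F η.hom i a).symm (tensorMap_of F θ.hom i a).symm

/-- The natural transformation `F ⊗ - → G ⊗ -` induced by `F → G`. -/
noncomputable def tensorFunctorMap {F G : Cᵒᵖ ⥤ AddCommGrpCat.{w}} (η : F ⟶ G) :
    tensorFunctor F ⟶ tensorFunctor G where
  app X := sumAtMap η X
  naturality X Y θ := by
    have hp : ∀ (x : C) (a : F.obj (op x)) (z : (freeFunctor Y).obj x),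
        sumAtMap η Y (freePairing F Y a z) = freePairing G Y (η.app _ a) z := by
      intro x a z
      have : (sumAtMap η Y).hom.comp (freePairing F Y a) = freePairing G Y (η.app _ a) := by
        refine freeFunctor_hom_ext Y fun i m => ?_
        refine (congrArg (sumAtMap η Y) (freePairing_of F Y a i m)).trans ?_
        rw [abSumMap_of, freePairing_of, NatTrans.naturality_apply]
      exact DFunLike.congr_fun this z
    refine abSum_ext _ _ fun i a => ?_
    change sumAtMap η Y
      (tensorMap F θ.hom (abSumOf (fun i => F.obj (op (ObjFamily.obj X i))) i a)) =
      tensorMap G θ.hom (sumAtMap η X (abSumOf (fun i => F.obj (op (ObjFamily.obj X i))) i a))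
    refine (congrArg (sumAtMap η Y) (tensorMap_of F θ.hom i a)).trans ?_
    rw [hp]
    refine Eq.trans ?_ (congrArg (tensorMap G θ.hom) (abSumMap_of (fun i => i)
      (fun i => η.app (op (X.obj i))) i a).symm)
    exact (tensorMap_of G θ.hom i _).symm

/-- A map `f` of the index sets and morphisms `d_{f i} → cᵢ` induce a morphism
`⨁ i, ℤ[C(cᵢ, -)] → ⨁ j, ℤ[C(dⱼ, -)]`. -/
noncomputable def freeMonomial {X Y : FreeCat C} (f : ObjFamily.idx X → ObjFamily.idx Y)
    (m : ∀ i, ObjFamily.obj Y (f i) ⟶ ObjFamily.obj X i) : X ⟶ Y :=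
  InducedCategory.homMk
    { app x := abSumMap f fun i => ((freeYoneda C).obj x).map (m i).op
      naturality x y g := by
        refine (abSumMap_comp _ _ _ _).trans (Eq.trans ?_ (abSumMap_comp _ _ _ _).symm)
        exact congrArg (abSumMap _)
          (funext fun i => (((freeYoneda C).map g).naturality (m i).op).symm) }

theorem freeMonomial_of {X Y : FreeCat C} (f : ObjFamily.idx X → ObjFamily.idx Y)
    (m : ∀ i, ObjFamily.obj Y (f i) ⟶ ObjFamily.obj X i) {x : C} (i : ObjFamily.idx X)
    (p : ObjFamily.obj X i ⟶ x) :
    (freeMonomial f m).hom.app x (freeFunctorOf X i p) = freeFunctorOf Y (f i) (m i ≫ p) := by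
  refine (abSumMap_of _ _ _ _).trans ?_
  refine congrArg (abSumOf _ (f i)) ?_
  exact FreeAbelianGroup.map_of_apply p

theorem tensorFunctor_map_freeMonomial {X Y : FreeCat C} (f : ObjFamily.idx X → ObjFamily.idx Y)
    (m : ∀ i, ObjFamily.obj Y (f i) ⟶ ObjFamily.obj X i) :
    (tensorFunctor F).map (freeMonomial f m) = abSumMap f fun i => F.map (m i).op := by
  refine abSum_ext _ _ fun i a => ?_
  refine (tensorMap_of F _ i a).trans ?_
  refine (congrArg (freePairing F Y a) (freeMonomial_of f m i (𝟙 _))).trans ?_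
  rw [freePairing_of, Category.comp_id]
  exact (abSumMap_of (A := fun i => F.obj (op (ObjFamily.obj X i)))
    (B := fun i => F.obj (op (ObjFamily.obj Y i))) f (fun i => F.map (m i).op) i a).symm

end SumAt

/-! ### Comparison of resolutions by sums of representable functors -/

section Comparison

theorem CategoryTheory.ShortComplex.exact_of_evaluation_exact {C : Type u} [Category.{v} C]
    (S : ShortComplex (C ⥤ AddCommGrpCat.{w}))
    (h : ∀ x (a : S.X₂.obj x), S.g.app x a = 0 → ∃ b, S.f.app x b = a) : S.Exact := by
  rw [ShortComplex.exact_iff_isZero_homology, Functor.isZero_iff]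
  intro x
  refine Limits.IsZero.of_iso ?_ (S.mapHomologyIso ((evaluation _ _).obj x)).symm
  rw [← ShortComplex.exact_iff_isZero_homology, ShortComplex.ab_exact_iff]
  exact h x

/-- A complex of projective objects which is an exact resolution of `Z` is a projective
resolution. -/
noncomputable def CategoryTheory.ProjectiveResolution.ofExact {A : Type u} [Category.{v} A]
    [Abelian A] (K : ChainComplex A ℕ) (hK : ∀ n, Projective (K.X n)) {Z : A} (π : K.X 0 ⟶ Z)
    (hπ : K.d 1 0 ≫ π = 0) (hepi : Epi π) (h₀ : (ShortComplex.mk _ _ hπ).Exact)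
    (h : ∀ n, (ShortComplex.mk _ _ (K.d_comp_d (n + 2) (n + 1) n)).Exact) :
    ProjectiveResolution Z where
  complex := K
  projective := hK
  π := (ChainComplex.toSingle₀Equiv _ _).symm ⟨π, hπ⟩
  quasiIso := ⟨fun n => by
    cases n
    · rw [ChainComplex.quasiIsoAt₀_iff, ShortComplex.quasiIso_iff_of_zeros']
      · refine (ShortComplex.exact_and_epi_g_iff_of_iso ?_).2 ⟨h₀, hepi⟩
        exact ShortComplex.isoMk (Iso.refl _) (Iso.refl _) (Iso.refl _)
          ((Category.id_comp _).trans (Category.comp_id _).symm)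
          ((Category.id_comp _).trans ((Category.comp_id _).trans
            (ChainComplex.toSingle₀Equiv_symm_apply_f_zero π hπ)).symm)
      · exact K.shape _ _ (by simp)
      all_goals rfl
    · rw [quasiIsoAt_iff_exactAt']
      · rw [HomologicalComplex.exactAt_iff' _ _ _ _ (by simp; rfl) (by simp; rfl)]
        exact h _
      · apply ChainComplex.exactAt_succ_single_obj⟩

variable {C : Type u} [Category.{u} C]

/-- The augmentation `⨁ i, ℤ[C(cᵢ, -)] → ℤ`, with value `1` on the basis. -/
noncomputable def augmentation (X : ObjFamily C) :
    freeFunctor X ⟶ (Functor.const C).obj (AddCommGrpCat.of (ULift.{u} ℤ)) :=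
  freeFunctorDesc X fun _ => ULift.up 1

theorem augmentation_of (X : ObjFamily C) {x : C} (i : X.idx) (m : X.obj i ⟶ x) :
    (augmentation X).app x (freeFunctorOf X i m) = ULift.up 1 :=
  freeFunctorDesc_of X _ i m

theorem augmentation_surjective (X : ObjFamily C) {x : C}
    (h : ∃ z : (freeFunctor X).obj x, (augmentation X).app x z = ULift.up 1) :
    Function.Surjective ((augmentation X).app x) := fun k => by
  obtain ⟨z, hz⟩ := h
  refine ⟨k.down • z, ?_⟩
  rw [map_zsmul, hz]
  exact ULift.ext _ _ (by simp)

/-- A complex of sums of representable functors such that, at every object, the complex augmented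
by `ℤ` is exact. -/
structure IsFreeResolution (K : ChainComplex (FreeCat C) ℕ) : Prop where
  d_augmentation : ∀ x (z : (freeFunctor (K.X 1)).obj x),
    (augmentation (K.X 0)).app x ((K.d 1 0).hom.app x z) = 0
  surjective : ∀ x, ∃ z : (freeFunctor (K.X 0)).obj x,
    (augmentation (K.X 0)).app x z = ULift.up 1
  exact₀ : ∀ x (z : (freeFunctor (K.X 0)).obj x), (augmentation (K.X 0)).app x z = 0 →
    ∃ y, (K.d 1 0).hom.app x y = z
  exact_succ : ∀ n x (z : (freeFunctor (K.X (n + 1))).obj x),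
    (K.d (n + 1) n).hom.app x z = 0 → ∃ y, (K.d (n + 2) (n + 1)).hom.app x y = z

/-- The projective resolution of the constant functor `ℤ` given by a resolution by sums of
representable functors. -/
noncomputable def IsFreeResolution.projectiveResolution {K : ChainComplex (FreeCat C) ℕ}
    (hK : IsFreeResolution K) :
    ProjectiveResolution ((Functor.const C).obj (AddCommGrpCat.of (ULift.{u} ℤ))) :=
  ProjectiveResolution.ofExact (((inducedFunctor _).mapHomologicalComplex _).obj K)
    (fun n => freeFunctor_projective (K.X n)) (augmentation (K.X 0))
    (NatTrans.ext (funext fun x => AddCommGrpCat.hom_ext (AddMonoidHom.ext (hK.d_augmentation x))))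
    ((NatTrans.epi_iff_epi_app _).2 fun x => (AddCommGrpCat.epi_iff_surjective _).2
      (augmentation_surjective _ (hK.surjective x)))
    (ShortComplex.exact_of_evaluation_exact _ hK.exact₀)
    (fun n => ShortComplex.exact_of_evaluation_exact _ (hK.exact_succ n))

/-- Two resolutions of `ℤ` by sums of representable functors are homotopy equivalent, by maps
and homotopies between sums of representable functors. -/
noncomputable def IsFreeResolution.homotopyEquiv {K L : ChainComplex (FreeCat C) ℕ}
    (hK : IsFreeResolution K) (hL : IsFreeResolution L) : HomotopyEquiv K L :=
  let e : HomotopyEquiv (((inducedFunctor (freeFunctor (C := C))).mapHomologicalComplex _).obj K)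
      (((inducedFunctor _).mapHomologicalComplex _).obj L) :=
    ProjectiveResolution.homotopyEquiv hK.projectiveResolution hL.projectiveResolution
  HomotopyCategory.homotopyEquivOfIso
    (((inducedFunctor _).mapHomotopyCategory _).preimageIso
      (HomotopyCategory.isoOfHomotopyEquiv e))

/-- The complex `F ⊗ K` as a functor of `F`. -/
noncomputable def tensorComplex (K : ChainComplex (FreeCat C) ℕ) :
    (Cᵒᵖ ⥤ AddCommGrpCat.{w}) ⥤ ChainComplex AddCommGrpCat.{max u w} ℕ where
  obj F := ((tensorFunctor F).mapHomologicalComplex _).obj K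
  map η := (NatTrans.mapHomologicalComplex (tensorFunctorMap η) _).app K
  map_id _ := HomologicalComplex.Hom.ext (funext fun _ => abSumMap_id _)
  map_comp η θ := HomologicalComplex.Hom.ext (funext fun n =>
    (abSumMap_comp (fun i => i) (fun i => η.app (op (ObjFamily.obj (K.X n) i))) (fun i => i)
      (fun i => θ.app (op (ObjFamily.obj (K.X n) i)))).symm)

/-- The homology of `F ⊗ K`, as a functor of `F`, is the same for all resolutions `K` of `ℤ` by sums
of representable functors. -/
noncomputable def IsFreeResolution.tensorHomologyIso {K L : ChainComplex (FreeCat C) ℕ}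
    (hK : IsFreeResolution K) (hL : IsFreeResolution L) (n : ℕ) :
    (tensorComplex.{u, w} K ⋙ HomologicalComplex.homologyFunctor _ _ n) ≅
      tensorComplex.{u, w} L ⋙ HomologicalComplex.homologyFunctor _ _ n :=
  NatIso.ofComponents
    (fun F => ((tensorFunctor F).mapHomotopyEquiv (hK.homotopyEquiv hL)).toHomologyIso n)
    fun η => (HomologicalComplex.homologyMap_comp _ _ n).symm.trans
      ((congrArg (fun f => HomologicalComplex.homologyMap f n)
        (NatTrans.mapHomologicalComplex_naturality (tensorFunctorMap η)
          (hK.homotopyEquiv hL).hom).symm).trans (HomologicalComplex.homologyMap_comp _ _ n))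

end Comparison

/-! ### The resolution by chains of morphisms -/

section Bar

variable (C : Type u) [Category.{u} C]

/-- The simplicial object whose `n`-simplices are the sum of the functors `ℤ[C(c₀, -)]` over the
chains `c₀ ← ⋯ ← cₙ` in `C`, that is, over the chains `c₀ → ⋯ → cₙ` in `Cᵒᵖ`. -/
noncomputable def barObject : SimplicialObject (FreeCat C) where
  obj Δ := ⟨ComposableArrows Cᵒᵖ Δ.unop.len, fun c => (c.obj 0).unop⟩
  map {Δ _} θ := freeMonomial
    (fun c : ComposableArrows Cᵒᵖ Δ.unop.len =>
      c.whiskerLeft (SimplexCategory.toCat.map θ.unop).toFunctor)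
    (fun c => (c.map (homOfLE (Fin.zero_le (θ.unop.toOrderHom 0)))).unop)
  map_id Δ := InducedCategory.hom_ext (NatTrans.ext (funext fun x =>
    (simplicialChains Cᵒᵖ ((freeYoneda C).obj x)).map_id Δ))
  map_comp f g := InducedCategory.hom_ext (NatTrans.ext (funext fun x =>
    (simplicialChains Cᵒᵖ ((freeYoneda C).obj x)).map_comp f g))

/-- The alternating face map complex of `barObject C`. -/
noncomputable def barComplex : ChainComplex (FreeCat C) ℕ :=
  (AlgebraicTopology.alternatingFaceMapComplex _).obj (barObject C)

theorem tensorFunctor_map_barObject (F : Cᵒᵖ ⥤ AddCommGrpCat.{w}) {Δ Δ' : SimplexCategoryᵒᵖ}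
    (θ : Δ ⟶ Δ') :
    (tensorFunctor F).map ((barObject C).map θ) = (simplicialChains Cᵒᵖ F).map θ :=
  tensorFunctor_map_freeMonomial F _ _

/-- The complex `F ⊗ barComplex C` is the chain complex of `Cᵒᵖ` with coefficients in `F`. -/
noncomputable def tensorBarComplexIso : tensorComplex.{u, w} (barComplex C) ≅ categoryChains Cᵒᵖ :=
  NatIso.ofComponents
    (fun F => HomologicalComplex.Hom.isoOfComponents (fun n => Iso.refl _) (by
      rintro _ j rfl
      refine (Category.id_comp _).trans (Eq.trans ?_ (Category.comp_id _).symm)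
      refine (AlgebraicTopology.AlternatingFaceMapComplex.obj_d_eq _ _).trans (Eq.trans ?_
        (congrArg (tensorFunctor F).map
          (AlgebraicTopology.AlternatingFaceMapComplex.obj_d_eq (barObject C) j)).symm)
      rw [Functor.map_sum]
      refine Finset.sum_congr rfl fun i _ => ?_
      rw [Functor.map_zsmul]
      exact congrArg _ (tensorFunctor_map_barObject C F _).symm))
    fun η => HomologicalComplex.Hom.ext (funext fun n =>
      (Category.comp_id _).trans (Category.id_comp _).symm)


variable {C}

theorem freeFunctorOf_congr (X : ObjFamily C) {x : C} {i j : X.idx} (h : i = j)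
    (m : X.obj i ⟶ x) (m' : X.obj j ⟶ x)
    (hm : m = eqToHom (congrArg X.obj h) ≫ m') : freeFunctorOf X i m = freeFunctorOf X j m' := by
  subst h
  rw [hm, eqToHom_refl, Category.id_comp]

theorem toCat_map_δ_zero (n : ℕ) :
    (SimplexCategory.toCat.map (SimplexCategory.δ (n := n) 0)).toFunctor =
      Fin.succFunctor (n + 1) :=
  CategoryTheory.Functor.ext (fun j => Fin.succAbove_zero_apply j) fun _ _ _ => rfl

theorem succFunctor_comp_toCat_map_δ_succ (n : ℕ) (i : Fin (n + 2)) :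
    Fin.succFunctor (n + 1) ⋙ (SimplexCategory.toCat.map (SimplexCategory.δ i.succ)).toFunctor =
      (SimplexCategory.toCat.map (SimplexCategory.δ i)).toFunctor ⋙ Fin.succFunctor (n + 2) :=
  CategoryTheory.Functor.ext (fun j => Fin.succ_succAbove_succ i j) fun _ _ _ => rfl

theorem precomp_δ_zero {D : Type u} [Category.{u} D] {n : ℕ} (c : ComposableArrows D n) {X : D}
    (f : X ⟶ c.left) :
    (c.precomp f).whiskerLeft (SimplexCategory.toCat.map (SimplexCategory.δ 0)).toFunctor = c := by
  rw [toCat_map_δ_zero]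
  rfl

/-- Deleting a later vertex commutes with prefixing a morphism, up to composing that morphism with
`c₀ → c₁` if `c₀` is deleted. -/
theorem precomp_δ_succ {D : Type u} [Category.{u} D] {n : ℕ}
    (c : ComposableArrows D (n + 1)) {X : D} (f : X ⟶ c.left) (i : Fin (n + 2)) :
    (c.precomp f).whiskerLeft (SimplexCategory.toCat.map (SimplexCategory.δ i.succ)).toFunctor =
      (c.whiskerLeft (SimplexCategory.toCat.map (SimplexCategory.δ i)).toFunctor).precomp
        (f ≫ c.map (homOfLE (Fin.zero_le ((SimplexCategory.δ i).toOrderHom 0)))) := by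
  refine ComposableArrows.ext_succ ?_ ?_ ?_
  · rfl
  · exact congrArg (fun φ => (c.precomp f).whiskerLeft φ)
      (succFunctor_comp_toCat_map_δ_succ n i)
  · cases i using Fin.cases with
    | zero =>
      refine Eq.trans ?_ (Category.id_comp _).symm
      refine Eq.trans ?_ (Category.comp_id _).symm
      rfl
    | succ i =>
      refine Eq.trans ?_ (Category.id_comp _).symm
      refine Eq.trans ?_ (Category.comp_id _).symm
      refine Eq.trans ?_ (congrArg (f ≫ ·) (c.map_id 0)).symm
      exact (Category.comp_id f).symm

/-- The extra degeneracy `(c₀ → ⋯ → cₙ, m) ↦ (x → c₀ → ⋯ → cₙ, 𝟙 x)` of the complex of chains over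
an object `x`. -/
noncomputable def barExtra (n : ℕ) (x : C) :
    (freeFunctor ((barComplex C).X n)).obj x ⟶ (freeFunctor ((barComplex C).X (n + 1))).obj x :=
  freeFunctorHom ((barComplex C).X n) fun (c : ComposableArrows Cᵒᵖ n) (m : (c.obj 0).unop ⟶ x) =>
    freeFunctorOf ((barComplex C).X (n + 1)) (i := c.precomp (X := op x) m.op) (𝟙 x)

variable (C) in
/-- The value of a sum of representable functors at an object `x`. -/
noncomputable abbrev evalAt (x : C) : FreeCat C ⥤ AddCommGrpCat.{u} :=
  inducedFunctor _ ⋙ (evaluation _ _).obj x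

theorem barExtra_of {n : ℕ} {x : C} (c : ComposableArrows Cᵒᵖ n) (m : (c.obj 0).unop ⟶ x) :
    barExtra n x (freeFunctorOf ((barComplex C).X n) (i := c) m) =
      freeFunctorOf ((barComplex C).X (n + 1)) (i := c.precomp (X := op x) m.op) (𝟙 x) :=
  freeFunctorHom_of _ _ _ _

theorem barObject_δ_of {n : ℕ} {x : C} (i : Fin (n + 2)) (c : ComposableArrows Cᵒᵖ (n + 1))
    (m : (c.obj 0).unop ⟶ x) :
    (evalAt C x).map ((barObject C).δ i) (freeFunctorOf ((barComplex C).X (n + 1)) (i := c) m) =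
      freeFunctorOf ((barComplex C).X n)
        (i := c.whiskerLeft (SimplexCategory.toCat.map (SimplexCategory.δ i)).toFunctor)
        ((c.map (homOfLE (Fin.zero_le ((SimplexCategory.δ i).toOrderHom 0)))).unop ≫ m) :=
  freeMonomial_of _ _ _ _

theorem barExtra_δ_zero (n : ℕ) (x : C) :
    barExtra n x ≫ (evalAt C x).map ((barObject C).δ 0) = 𝟙 _ := by
  refine freeFunctor_ext _ fun c m => ?_
  refine (congrArg ((evalAt C x).map ((barObject C).δ 0)) (barExtra_of c m)).trans ?_
  refine (barObject_δ_of _ _ _).trans ?_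
  refine freeFunctorOf_congr ((barComplex C).X n)
    (precomp_δ_zero (D := Cᵒᵖ) c (X := op x) m.op) _ _ ?_
  refine (Category.comp_id _).trans (Category.id_comp m).symm

theorem barExtra_δ_succ (n : ℕ) (x : C) (i : Fin (n + 2)) :
    barExtra (n + 1) x ≫ (evalAt C x).map ((barObject C).δ i.succ) =
      (evalAt C x).map ((barObject C).δ i) ≫ barExtra n x := by
  refine freeFunctor_ext _ fun c m => ?_
  refine (congrArg ((evalAt C x).map ((barObject C).δ i.succ)) (barExtra_of c m)).trans ?_
  refine (barObject_δ_of _ _ _).trans ?_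
  refine Eq.trans ?_ (congrArg (barExtra n x) (barObject_δ_of i c m)).symm
  refine Eq.trans ?_ (barExtra_of _ _).symm
  refine freeFunctorOf_congr ((barComplex C).X (n + 1))
    (precomp_δ_succ (D := Cᵒᵖ) c (X := op x) m.op i) _ _ ?_
  rfl

theorem barComplex_d (n : ℕ) (x : C) :
    (evalAt C x).map ((barComplex C).d (n + 1) n) =
      ∑ i : Fin (n + 2), (-1 : ℤ) ^ (i : ℕ) • (evalAt C x).map ((barObject C).δ i) := by
  refine (congrArg (evalAt C x).map
    (AlgebraicTopology.AlternatingFaceMapComplex.obj_d_eq (barObject C) n)).trans ?_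
  rw [Functor.map_sum]
  exact Finset.sum_congr rfl fun i _ => Functor.map_zsmul _

/-- An extra degeneracy contracts the alternating sums of the face maps. -/
theorem extra_degeneracy_comp_alternating_sum {A : Type v} [Category.{w} A] [Preadditive A] {n : ℕ}
    {A₀ A₁ A₂ : A} (d : Fin (n + 3) → (A₂ ⟶ A₁)) (d' : Fin (n + 2) → (A₁ ⟶ A₀)) (s : A₁ ⟶ A₂)
    (s' : A₀ ⟶ A₁) (h₀ : s ≫ d 0 = 𝟙 _) (h : ∀ i, s ≫ d i.succ = d' i ≫ s') :
    s ≫ ∑ i : Fin (n + 3), (-1 : ℤ) ^ (i : ℕ) • d i =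
      𝟙 _ - (∑ i : Fin (n + 2), (-1 : ℤ) ^ (i : ℕ) • d' i) ≫ s' := by
  rw [Fin.sum_univ_succ, Preadditive.comp_add, Preadditive.comp_sum,
    Preadditive.sum_comp, sub_eq_add_neg, ← Finset.sum_neg_distrib]
  refine congrArg₂ (· + ·) ?_ (Finset.sum_congr rfl fun i _ => ?_)
  · rw [Fin.val_zero, pow_zero, one_smul, h₀]
  · rw [Preadditive.comp_zsmul, Preadditive.zsmul_comp, h, Fin.val_succ, pow_succ,
      mul_neg_one, neg_smul]

theorem barExtra_d (n : ℕ) (x : C) :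
    barExtra (n + 1) x ≫ (evalAt C x).map ((barComplex C).d (n + 2) (n + 1)) =
      𝟙 _ - (evalAt C x).map ((barComplex C).d (n + 1) n) ≫ barExtra n x := by
  rw [barComplex_d, barComplex_d]
  exact extra_degeneracy_comp_alternating_sum _ _ _ _ (barExtra_δ_zero (n + 1) x)
    (barExtra_δ_succ n x)

theorem barComplex_d_zero (x : C) (z : (freeFunctor ((barComplex C).X 1)).obj x) :
    (evalAt C x).map ((barComplex C).d 1 0) z =
      (evalAt C x).map ((barObject C).δ 0) z - (evalAt C x).map ((barObject C).δ 1) z := by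
  rw [barComplex_d, Fin.sum_univ_two, Fin.val_zero, Fin.val_one, pow_zero, pow_one, one_smul,
    neg_one_smul, ← sub_eq_add_neg]
  rfl

/-- In degree `0` the extra degeneracy contracts onto the chain `x`. -/
theorem barExtra_δ_one (x : C) (z : (freeFunctor ((barComplex C).X 0)).obj x) :
    (evalAt C x).map ((barObject C).δ 1) (barExtra 0 x z) =
      ((augmentation ((barComplex C).X 0)).app x z).down •
        freeFunctorOf ((barComplex C).X 0) (i := ComposableArrows.mk₀ (op x)) (𝟙 x) := by
  have h : (barExtra 0 x ≫ (evalAt C x).map ((barObject C).δ 1)).hom =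
      ((zmultiplesHom ((freeFunctor ((barComplex C).X 0)).obj x) (freeFunctorOf ((barComplex C).X 0)
        (i := ComposableArrows.mk₀ (op x)) (𝟙 x))).comp AddEquiv.ulift.toAddMonoidHom).comp
        ((augmentation ((barComplex C).X 0)).app x).hom := by
    refine freeFunctor_hom_ext _ fun c m => ?_
    refine (congrArg ((evalAt C x).map ((barObject C).δ 1)) (barExtra_of c m)).trans ?_
    refine (barObject_δ_of _ _ _).trans ?_
    refine Eq.trans ?_ (congrArg (fun k : ULift ℤ => k.down •
      freeFunctorOf ((barComplex C).X 0) (i := ComposableArrows.mk₀ (op x)) (𝟙 x))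
      (augmentation_of ((barComplex C).X 0) c m)).symm
    refine Eq.trans ?_ (one_smul ℤ _).symm
    refine freeFunctorOf_congr ((barComplex C).X 0)
      (ComposableArrows.ext₀ (C := Cᵒᵖ)
        (F := (c.precomp (X := op x) m.op).whiskerLeft
          (SimplexCategory.toCat.map (SimplexCategory.δ 1)).toFunctor)
        (G := ComposableArrows.mk₀ (op x)) rfl) _ _ ?_
    rfl
  exact DFunLike.congr_fun h z

theorem augmentation_barObject_δ (x : C) (i : Fin 2)
    (z : (freeFunctor ((barComplex C).X 1)).obj x) :
    (augmentation ((barComplex C).X 0)).app x ((evalAt C x).map ((barObject C).δ i) z) =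
      (augmentation ((barComplex C).X 1)).app x z := by
  have h : ((augmentation ((barComplex C).X 0)).app x).hom.comp
      ((evalAt C x).map ((barObject C).δ i)).hom =
        ((augmentation ((barComplex C).X 1)).app x).hom := by
    refine freeFunctor_hom_ext _ fun c m => ?_
    refine (congrArg ((augmentation ((barComplex C).X 0)).app x) (barObject_δ_of i c m)).trans ?_
    exact (augmentation_of _ _ _).trans (augmentation_of _ _ _).symm
  exact DFunLike.congr_fun h z

theorem barComplex_isFreeResolution : IsFreeResolution (barComplex C) where
  d_augmentation x z := by
    refine (congrArg ((augmentation ((barComplex C).X 0)).app x) (barComplex_d_zero x z)).trans ?_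
    refine (map_sub ((augmentation ((barComplex C).X 0)).app x).hom _ _).trans ?_
    exact sub_eq_zero.2
      ((augmentation_barObject_δ x 0 z).trans (augmentation_barObject_δ x 1 z).symm)
  surjective x := ⟨freeFunctorOf _ (i := ComposableArrows.mk₀ (op x)) (𝟙 x), augmentation_of _ _ _⟩
  exact₀ x z hz := by
    refine ⟨barExtra 0 x z, (barComplex_d_zero x _).trans ?_⟩
    rw [barExtra_δ_one, hz]
    refine (congrArg₂ (· - ·) (ConcreteCategory.congr_hom (barExtra_δ_zero 0 x) z)
      (zero_smul ℤ _)).trans (sub_zero z)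
  exact_succ n x z hz := by
    refine ⟨barExtra (n + 1) x z, ?_⟩
    have h := ConcreteCategory.congr_hom (barExtra_d n x) z
    refine h.trans ?_
    change z - barExtra n x ((evalAt C x).map ((barComplex C).d (n + 1) n) z) = z
    have hz' : (evalAt C x).map ((barComplex C).d (n + 1) n) z = 0 := hz
    rw [hz', map_zero, sub_zero]

end Bar

/-! ### The complex of a semicubical set over a category -/

section CubicalFree

variable {C : Type u} [Category.{u} C] {X : Boxᵒᵖ ⥤ Type u} (S : BoxOver X ⥤ C)

/-- The sum of the functors `ℤ[C(S σ, -)]` over the `n`-cells `σ`. -/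
noncomputable def cubicalFreeX (n : ℕ) : FreeCat C :=
  (⟨X.obj (op ⟨n⟩), fun σ => S.obj ⟨n, σ⟩⟩ : ObjFamily C)

/-- The face operator `dᵢ^{n+1,ε}` between sums of representable functors. -/
noncomputable def cubicalFreeFace (n : ℕ) (i : Fin (n + 1)) (ε : Bool) :
    cubicalFreeX S (n + 1) ⟶ cubicalFreeX S n :=
  freeMonomial (fun σ : X.obj (op ⟨n + 1⟩) => cellFace X i ε σ)
    (fun σ => S.map (faceOver X i ε σ))

/-- The cubical differential between sums of representable functors. -/
noncomputable def cubicalFreeD (n : ℕ) : cubicalFreeX S (n + 1) ⟶ cubicalFreeX S n :=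
  ∑ i : Fin (n + 1),
    (-1 : ℤ) ^ (i.val + 1) • (cubicalFreeFace S n i true - cubicalFreeFace S n i false)

theorem map_cubicalFreeD {A : Type v} [Category.{w} A] [Preadditive A] (G : FreeCat C ⥤ A)
    [G.Additive] (n : ℕ) :
    G.map (cubicalFreeD S n) = ∑ i : Fin (n + 1), (-1 : ℤ) ^ (i.val + 1) •
      (G.map (cubicalFreeFace S n i true) - G.map (cubicalFreeFace S n i false)) := by
  rw [cubicalFreeD, Functor.map_sum]
  exact Finset.sum_congr rfl fun i _ => by rw [Functor.map_zsmul, Functor.map_sub]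

theorem tensorFunctor_map_cubicalFreeFace (F : Cᵒᵖ ⥤ AddCommGrpCat.{w}) (n : ℕ) (i : Fin (n + 1))
    (ε : Bool) :
    (tensorFunctor F).map (cubicalFreeFace S n i ε) = cubicalFace (S.op ⋙ F) n i ε :=
  tensorFunctor_map_freeMonomial F _ _

theorem tensorFunctor_map_cubicalFreeD (F : Cᵒᵖ ⥤ AddCommGrpCat.{w}) (n : ℕ) :
    (tensorFunctor F).map (cubicalFreeD S n) = cubicalD (S.op ⋙ F) n := by
  refine (map_cubicalFreeD S (tensorFunctor F) n).trans ?_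
  exact Finset.sum_congr rfl fun i _ => by
    rw [tensorFunctor_map_cubicalFreeFace, tensorFunctor_map_cubicalFreeFace]; rfl

theorem evalAt_map_cubicalFreeD (x : C) (n : ℕ) :
    (evalAt C x).map (cubicalFreeD S n) = cubicalD (S.op ⋙ (freeYoneda C).obj x) n :=
  map_cubicalFreeD S (evalAt C x) n

theorem cubicalFreeD_comp (n : ℕ) : cubicalFreeD S (n + 1) ≫ cubicalFreeD S n = 0 :=
  InducedCategory.hom_ext (NatTrans.ext (funext fun x => by
    change (evalAt C x).map (cubicalFreeD S (n + 1)) ≫ (evalAt C x).map (cubicalFreeD S n) = 0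
    rw [evalAt_map_cubicalFreeD, evalAt_map_cubicalFreeD]
    exact cubicalD_comp (S.op ⋙ (freeYoneda C).obj x) n))

/-- The cubical complex with values in sums of representable functors. -/
noncomputable def cubicalFreeComplex : ChainComplex (FreeCat C) ℕ :=
  ChainComplex.of (cubicalFreeX S) (cubicalFreeD S) (cubicalFreeD_comp S)

theorem cubicalFreeComplex_d (n : ℕ) : (cubicalFreeComplex S).d (n + 1) n = cubicalFreeD S n :=
  ChainComplex.of_d _ _ _

/-- The tensor product of `F` with `cubicalFreeComplex S` is the cubical complex of `F ∘ Sᵒᵖ`. -/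
noncomputable def tensorCubicalFreeIso :
    tensorComplex.{u, w} (cubicalFreeComplex S) ≅
      (Functor.whiskeringLeft _ _ _).obj S.op ⋙ cubicalComplex X :=
  NatIso.ofComponents
    (fun F => HomologicalComplex.Hom.isoOfComponents (fun n => Iso.refl _) (by
      rintro _ j rfl
      refine (Category.id_comp _).trans (Eq.trans ?_ (Category.comp_id _).symm)
      refine (ChainComplex.of_d _ _ _).trans (Eq.trans ?_
        (congrArg (tensorFunctor F).map (cubicalFreeComplex_d S j)).symm)
      exact (tensorFunctor_map_cubicalFreeD S F j).symm))
    fun η => HomologicalComplex.Hom.ext (funext fun n =>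
      (Category.comp_id _).trans (Category.id_comp _).symm)

/-- If the cubical complex over `S` resolves `ℤ`, then the cubical homology of `F ∘ Sᵒᵖ` is the
homology of `Cᵒᵖ` with coefficients in `F`. -/
noncomputable def categoryHomologyIsoCubicalHomology
    (h : IsFreeResolution (cubicalFreeComplex S)) (n : ℕ) :
    (categoryHomology Cᵒᵖ n : (Cᵒᵖ ⥤ AddCommGrpCat.{w}) ⥤ AddCommGrpCat.{max u w}) ≅
      (Functor.whiskeringLeft _ _ _).obj S.op ⋙ cubicalHomology X n :=
  Functor.isoWhiskerRight (tensorBarComplexIso.{u, w} C).symm _ ≪≫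
    barComplex_isFreeResolution.tensorHomologyIso h n ≪≫
    Functor.isoWhiskerRight (tensorCubicalFreeIso.{u, w} S) _

end CubicalFree

/-! ### Right divisibility by a letter in a trace monoid -/

namespace TraceMonoid

section RightDivision

variable {E : Type u} {I : E → E → Prop}

theorem induction_left {P : TraceMonoid I → Prop} (one : P 1)
    (mul : ∀ a m, P m → P (of I a * m)) (m : TraceMonoid I) : P m := by
  refine Submonoid.induction_of_closure_eq_top_left (PresentedMonoid.closure_range_of _) m one ?_
  rintro _ ⟨a, rfl⟩ y hy
  exact mul a y hy

theorem induction_right {P : TraceMonoid I → Prop} (one : P 1)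
    (mul : ∀ m a, P m → P (m * of I a)) (m : TraceMonoid I) : P m := by
  refine Submonoid.induction_of_closure_eq_top_right (PresentedMonoid.closure_range_of _) m one ?_
  rintro y _ ⟨a, rfl⟩ hy
  exact mul y a hy

/-- The result of looking for a letter `b` at the right end of an element `m` of a trace monoid. -/
inductive EndStatus (I : E → E → Prop) : Type u
  /-- All letters of the element `m` are independent of `b`. -/
  | indep (m : TraceMonoid I) : EndStatus I
  /-- The element is `m * b`. -/
  | divisible (m : TraceMonoid I) : EndStatus I
  /-- The last letter of the element which is not independent of `b` differs from `b`. -/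
  | blocked : EndStatus I

namespace EndStatus

open Classical in
/-- The effect on the status of multiplication by a letter `a` on the left. -/
noncomputable def letter (b a : E) : EndStatus I → EndStatus I
  | indep m => if a = b then divisible m else if I a b then indep (of I a * m) else blocked
  | divisible m => divisible (of I a * m)
  | blocked => blocked

/-- The effect on the status of multiplication by `n` on the right, for `n` with letters independent
of `b`. -/
def mulRight (n : TraceMonoid I) : EndStatus I → EndStatus I
  | indep m => indep (m * n)
  | divisible m => divisible (m * n)
  | blocked => blocked

theorem letter_mulRight (b a : E) (n : TraceMonoid I) (s : EndStatus I) :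
    letter b a (s.mulRight n) = (letter b a s).mulRight n := by
  cases s with
  | indep m =>
    simp only [letter, mulRight]
    split_ifs <;> simp [mul_assoc]
  | divisible m => simp [letter, mulRight, mul_assoc]
  | blocked => rfl

variable [Std.Irrefl I] [Std.Symm I]

theorem letter_comm {a a' : E} (h : I a a') (b : E) (s : EndStatus I) :
    letter b a (letter b a' s) = letter b a' (letter b a s) := by
  have hc : ∀ m, of I a * (of I a' * m) = of I a' * (of I a * m) := fun m => by
    rw [← mul_assoc, (of_commute h).eq, mul_assoc]
  have hne : a ≠ a' := fun e => Std.Irrefl.irrefl (r := I) a' (e ▸ h)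
  have h' : I a' a := Std.Symm.symm _ _ h
  cases s with
  | indep m =>
    by_cases hb : a = b
    · subst hb
      simp [letter, hne.symm, h']
    · by_cases hb' : a' = b
      · subst hb'
        simp [letter, hne, h]
      · by_cases hi : I a b <;> by_cases hi' : I a' b <;> simp [letter, hb, hb', hi, hi', hc]
  | divisible m => simp [letter, hc]
  | blocked => rfl

/-- The action of a trace monoid on statuses. -/
noncomputable def act (b : E) : TraceMonoid I →* Function.End (EndStatus I) :=
  PresentedMonoid.lift (M := Function.End (EndStatus I)) (fun a => letter b a) (by
    rintro _ _ ⟨a, a', h, rfl, rfl⟩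
    rw [map_mul, map_mul]
    exact funext fun s => letter_comm h b s)

theorem act_one (b : E) (s : EndStatus I) : act b 1 s = s :=
  congrFun (map_one (act b)) s

theorem act_mul (b : E) (m n : TraceMonoid I) (s : EndStatus I) :
    act b (m * n) s = act b m (act b n s) :=
  congrFun (map_mul (act b) m n) s

theorem act_of (b a : E) (s : EndStatus I) : act b (of I a) s = letter b a s := rfl

theorem act_divisible (b : E) (m n : TraceMonoid I) :
    act b m (divisible n) = divisible (m * n) := by
  induction m using induction_left with
  | one => rw [act_one, one_mul]
  | mul a m ih => rw [act_mul, ih, act_of, letter, mul_assoc]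

theorem act_blocked (b : E) (m : TraceMonoid I) : act b m blocked = blocked := by
  induction m using induction_left with
  | one => rw [act_one]
  | mul a m ih => rw [act_mul, ih, act_of, letter]

theorem act_mulRight (b : E) (m n : TraceMonoid I) (s : EndStatus I) :
    act b m (s.mulRight n) = (act b m s).mulRight n := by
  induction m using induction_left with
  | one => rw [act_one, act_one]
  | mul a m ih => rw [act_mul, act_mul, ih, act_of, act_of, letter_mulRight]

end EndStatus

open EndStatus

variable [Std.Irrefl I] [Std.Symm I]

/-- The status of an element of a trace monoid with respect to a letter `b`. -/
noncomputable def endStatus (b : E) (m : TraceMonoid I) : EndStatus I := act b m (indep 1)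

theorem endStatus_one (b : E) : endStatus b (1 : TraceMonoid I) = indep 1 := act_one b _

theorem endStatus_mul (b : E) (m n : TraceMonoid I) :
    endStatus b (m * n) = act b m (endStatus b n) := act_mul b m n _

theorem endStatus_of_mul (b a : E) (m : TraceMonoid I) :
    endStatus b (of I a * m) = letter b a (endStatus b m) := act_mul b _ m _

theorem endStatus_mul_of (b : E) (m : TraceMonoid I) :
    endStatus b (m * of I b) = divisible m := by
  rw [endStatus_mul, endStatus, act_of, letter, if_pos rfl, act_divisible, mul_one]

theorem mul_of_right_cancel {b : E} {m n : TraceMonoid I} (h : m * of I b = n * of I b) :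
    m = n := by
  have := endStatus_mul_of b m
  rw [h, endStatus_mul_of] at this
  exact (divisible.inj this).symm

theorem eq_and_commute_of_endStatus_eq_indep {b : E} {m n : TraceMonoid I}
    (h : endStatus b m = indep n) : n = m ∧ Commute (of I b) m := by
  induction m using induction_left generalizing n with
  | one => exact ⟨(indep.inj ((endStatus_one b).symm.trans h)).symm, Commute.one_right _⟩
  | mul a m ih =>
    rw [endStatus_of_mul] at h
    cases hm : endStatus b m with
    | indep k =>
      obtain ⟨rfl, hc⟩ := ih hm
      rw [hm, letter] at h
      split_ifs at h with h₁ h₂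
      exact ⟨(indep.inj h).symm, (of_commute h₂).symm.mul_right hc⟩
    | divisible k => rw [hm] at h; cases h
    | blocked => rw [hm] at h; cases h

theorem eq_mul_of_endStatus_eq_divisible {b : E} {m n : TraceMonoid I}
    (h : endStatus b m = divisible n) : m = n * of I b := by
  induction m using induction_left generalizing n with
  | one => exact nomatch (endStatus_one b).symm.trans h
  | mul a m ih =>
    rw [endStatus_of_mul] at h
    cases hm : endStatus b m with
    | indep k =>
      obtain ⟨rfl, hc⟩ := eq_and_commute_of_endStatus_eq_indep hm
      rw [hm, letter] at h
      split_ifs at h with h₁ h₂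
      rw [← divisible.inj h, h₁, hc.eq]
    | divisible k =>
      rw [hm, letter] at h
      rw [← divisible.inj h, ih hm, mul_assoc]
    | blocked => rw [hm] at h; cases h

theorem independent_of_endStatus_prod_ne_blocked {b : E} {l : List E} (hb : b ∉ l)
    (h : endStatus b (l.map (of I)).prod ≠ blocked) :
    (∀ a ∈ l, I a b) ∧ endStatus b (l.map (of I)).prod = indep (l.map (of I)).prod := by
  induction l with
  | nil => exact ⟨by simp, endStatus_one b⟩
  | cons a l ih =>
    rw [List.map_cons, List.prod_cons, endStatus_of_mul] at h ⊢
    obtain ⟨h₁, h₂⟩ := ih (fun hl => hb (List.mem_cons_of_mem _ hl)) fun hl => h (by rw [hl]; rfl)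
    have ha : a ≠ b := fun e => hb (e ▸ List.mem_cons_self)
    rw [h₂, letter, if_neg ha] at h ⊢
    by_cases hi : I a b
    · rw [if_pos hi]
      exact ⟨fun x hx => (List.mem_cons.1 hx).elim (fun e => e ▸ hi) (h₁ x), rfl⟩
    · exact absurd (if_neg hi) h

/-- If `b` divides `g s f` on the right, where `s` is a product of distinct pairwise independent
letters, then either `b` divides `f`, or `f` has only letters independent of `b` and `b` is a
letter of `s`, or `f` and `s` have only letters independent of `b` and `b` divides `g`. -/
theorem right_division_cases {b : E} {g f m : TraceMonoid I} {l : List E}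
    (h : g * (l.map (of I)).prod * f = m * of I b) :
    (∃ f', f = f' * of I b) ∨ (endStatus b f = indep f ∧ b ∈ l) ∨
      (endStatus b f = indep f ∧ (∀ a ∈ l, I a b) ∧ ∃ g', g = g' * of I b) := by
  have hs : endStatus b (g * (l.map (of I)).prod * f) = divisible m := by
    rw [h, endStatus_mul_of]
  cases hf : endStatus b f with
  | divisible f' => exact Or.inl ⟨f', eq_mul_of_endStatus_eq_divisible hf⟩
  | blocked =>
    rw [endStatus_mul, hf, act_blocked] at hs
    cases hs
  | indep k =>
    obtain ⟨rfl, hc⟩ := eq_and_commute_of_endStatus_eq_indep hf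
    refine Or.inr ?_
    by_cases hb : b ∈ l
    · exact Or.inl ⟨rfl, hb⟩
    · refine Or.inr ⟨rfl, ?_⟩
      have hk : indep k = (indep (1 : TraceMonoid I)).mulRight k := by rw [mulRight, one_mul]
      rw [endStatus_mul, hf, hk, act_mulRight, ← endStatus, endStatus_mul] at hs
      have hne : endStatus b (l.map (of I)).prod ≠ blocked := fun e => by
        rw [e, act_blocked] at hs
        cases hs
      obtain ⟨h₁, h₂⟩ := independent_of_endStatus_prod_ne_blocked hb hne
      have hl : indep (l.map (of I)).prod =
          (indep (1 : TraceMonoid I)).mulRight (l.map (of I)).prod := by rw [mulRight, one_mul]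
      rw [h₂, hl, act_mulRight, ← endStatus] at hs
      refine ⟨h₁, ?_⟩
      cases hg : endStatus b g with
      | indep g' => rw [hg] at hs; cases hs
      | divisible g' => exact ⟨g', eq_mul_of_endStatus_eq_divisible hg⟩
      | blocked => rw [hg] at hs; cases hs

end RightDivision

section Length

variable {E : Type u} (I : E → E → Prop)

/-- The length of an element of a trace monoid. -/
def length : TraceMonoid I →* Multiplicative ℕ :=
  PresentedMonoid.lift (fun _ => Multiplicative.ofAdd 1) (by
    rintro _ _ ⟨a, b, -, rfl, rfl⟩
    simp)

theorem length_of (a : E) : length I (of I a) = Multiplicative.ofAdd 1 := rfl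

variable {I}

theorem eq_one_and_eq_one_of_mul_eq_one {m n : TraceMonoid I} (h : m * n = 1) : m = 1 ∧ n = 1 := by
  have key : ∀ k : TraceMonoid I, (length I k).toAdd = 0 → k = 1 := by
    intro k hk
    induction k using induction_left with
    | one => rfl
    | mul a k _ =>
      rw [map_mul, length_of, toAdd_mul, toAdd_ofAdd] at hk
      omega
  have hl := congrArg Multiplicative.toAdd (congrArg (length I) h)
  rw [map_mul, map_one, toAdd_mul, toAdd_one] at hl
  exact ⟨key m (by omega), key n (by omega)⟩

theorem of_ne_one (a : E) : of I a ≠ 1 := fun h => by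
  have := congrArg Multiplicative.toAdd (congrArg (length I) h)
  rw [length_of, MonoidHom.map_one] at this
  exact one_ne_zero this

end Length

end TraceMonoid

/-! ### Cells of the generalized torus -/

namespace TorusCell

variable {E : Type u} [LinearOrder E] {I : E → E → Prop} {n : ℕ}

theorem strictMono (a : TorusCell I n) : StrictMono a.1 := fun i j h => (a.2 i j h).1

theorem ext_of_range_eq {a b : TorusCell I n} (h : Set.range a.1 = Set.range b.1) : a = b :=
  Subtype.ext ((StrictMono.range_inj a.strictMono b.strictMono).1 h)

/-- The cell obtained by omitting the `i`-th letter. -/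
def face (i : Fin (n + 1)) (a : TorusCell I (n + 1)) : TorusCell I n :=
  ⟨fun k => a.1 (i.succAbove k), fun _ _ h => a.2 _ _ (Fin.strictMono_succAbove i h)⟩

theorem face_apply (i : Fin (n + 1)) (a : TorusCell I (n + 1)) (k : Fin n) :
    (a.face i).1 k = a.1 (i.succAbove k) := rfl

theorem cellFace_torus (i : Fin (n + 1)) (ε : Bool) (a : TorusCell I (n + 1)) :
    cellFace (torus I) i ε a = a.face i :=
  Subtype.ext (torus_face I i ε a)

theorem face_face (p : Fin (n + 2)) (k : Fin (n + 1)) (a : TorusCell I (n + 2)) :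
    (a.face p).face k = (a.face (p.succAbove k)).face (k.predAbove p) :=
  Subtype.ext (funext fun l =>
    congrArg a.1 (Fin.succAbove_succAbove_succAbove_predAbove p k l).symm)

/-- The product of the letters of a cell. -/
noncomputable def prod (a : TorusCell I n) : TraceMonoid I :=
  orderedProd fun k => TraceMonoid.of I (a.1 k)

theorem prod_eq_list_prod (a : TorusCell I n) :
    a.prod = ((List.ofFn a.1).map (TraceMonoid.of I)).prod := by
  rw [prod, orderedProd, List.map_ofFn]
  rfl

theorem face_prod_mul (i : Fin (n + 1)) (a : TorusCell I (n + 1)) :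
    (a.face i).prod * TraceMonoid.of I (a.1 i) = a.prod := by
  have h := ((torusToFact I).map (faceOver (torus I) i false a)).mul_eq
  have hf := torusToFact_face (I := I) i false a
  rw [hf.1, hf.2, Bool.toNat_false, pow_zero, one_mul, Nat.sub_zero, pow_one,
    cellFace_torus] at h
  exact h

theorem of_mul_face_prod (i : Fin (n + 1)) (a : TorusCell I (n + 1)) :
    TraceMonoid.of I (a.1 i) * (a.face i).prod = a.prod := by
  have h := ((torusToFact I).map (faceOver (torus I) i true a)).mul_eq
  have hf := torusToFact_face (I := I) i true a
  rw [hf.1, hf.2, Bool.toNat_true, pow_one, Nat.sub_self, pow_zero, mul_one,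
    cellFace_torus] at h
  exact h

theorem range_eq_insert (p : Fin (n + 1)) (c : TorusCell I (n + 1)) :
    Set.range c.1 = insert (c.1 p) (Set.range (c.face p).1) := by
  ext x
  constructor
  · rintro ⟨j, rfl⟩
    induction j using Fin.succAboveCases p with
    | x => exact Set.mem_insert _ _
    | p k => exact Set.mem_insert_of_mem _ ⟨k, rfl⟩
  · rintro (rfl | ⟨k, rfl⟩)
    · exact ⟨p, rfl⟩
    · exact ⟨p.succAbove k, rfl⟩

/-- A cell is determined by one of its letters and the other letters. -/
theorem eq_of_face_eq {p p' : Fin (n + 1)} {c c' : TorusCell I (n + 1)} (h : c.1 p = c'.1 p')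
    (hf : c.face p = c'.face p') : p = p' ∧ c = c' := by
  have hc : c = c' := ext_of_range_eq (by rw [range_eq_insert p, range_eq_insert p', h, hf])
  subst hc
  exact ⟨c.strictMono.injective h, rfl⟩

/-- A letter independent of the letters of a cell can be inserted into it. -/
theorem exists_face_eq [Std.Irrefl I] [Std.Symm I] (a : TorusCell I n) {b : E}
    (h : ∀ k, I (a.1 k) b) :
    ∃ (p : Fin (n + 1)) (c : TorusCell I (n + 1)), c.1 p = b ∧ c.face p = a := by
  classical
  have hb : b ∉ Set.range a.1 := by
    rintro ⟨k, rfl⟩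
    exact Std.Irrefl.irrefl (r := I) _ (h k)
  let s : Finset E := insert b (Finset.univ.image a.1)
  have hs : s.card = n + 1 := by
    rw [Finset.card_insert_of_notMem (by simpa using hb),
      Finset.card_image_of_injective _ a.strictMono.injective, Finset.card_univ, Fintype.card_fin]
  let e := s.orderEmbOfFin hs
  have he : ∀ i, e i = b ∨ ∃ k, a.1 k = e i := fun i =>
    (Finset.mem_insert.1 (s.orderEmbOfFin_mem hs i)).imp id fun h => by
      obtain ⟨k, -, hk⟩ := Finset.mem_image.1 h
      exact ⟨k, hk⟩
  have ha : ∀ k l, a.1 k < a.1 l → I (a.1 k) (a.1 l) := fun k l hkl =>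
    (a.2 k l (a.strictMono.lt_iff_lt.1 hkl)).2
  let c : TorusCell I (n + 1) := ⟨e, fun i j hij => by
    have hlt := e.strictMono hij
    refine ⟨hlt, ?_⟩
    rcases he i with hi | ⟨k, hk⟩ <;> rcases he j with hj | ⟨l, hl⟩
    · exact absurd (hi.trans hj.symm) hlt.ne
    · rw [hi, ← hl]
      exact Std.Symm.symm _ _ (h l)
    · rw [hj, ← hk]
      exact h k
    · rw [← hk, ← hl] at hlt ⊢
      exact ha k l hlt⟩
  have hr : Set.range c.1 = insert b (Set.range a.1) := by
    refine (s.range_orderEmbOfFin hs).trans ?_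
    simp [s]
  obtain ⟨p, hp⟩ : b ∈ Set.range c.1 := hr ▸ Set.mem_insert _ _
  refine ⟨p, c, hp, ext_of_range_eq ?_⟩
  have hp' : b ∉ Set.range (c.face p).1 := by
    rintro ⟨k, hk⟩
    exact p.succAbove_ne k (c.strictMono.injective (hk.trans hp.symm))
  rw [range_eq_insert p, hp] at hr
  rw [← Set.insert_sdiff_self_of_notMem hp', hr, Set.insert_sdiff_self_of_notMem hb]

end TorusCell

/-! ### Exactness of the complex of the generalized torus -/

section TorusExact

open TraceMonoid

variable {E : Type u} [LinearOrder E] {I : E → E → Prop}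

variable (I) in
/-- The value at `α` of the cubical complex of the torus in degree `n`: the free abelian group on
the triples `(a, f, g)`, where `a` is an `n`-cell with `g a f = α`. -/
def TorusChains (n : ℕ) (α : TraceMonoid I) : Type u :=
  (freeFunctor (cubicalFreeX (torusToFact I) n)).obj ⟨α⟩

noncomputable instance (n : ℕ) (α : TraceMonoid I) : AddCommGroup (TorusChains I n α) :=
  inferInstanceAs (AddCommGroup ((freeFunctor (cubicalFreeX (torusToFact I) n)).obj ⟨α⟩))

namespace TorusChains

variable {n : ℕ} {α : TraceMonoid I}

/-- The basis element `(a, f, g)`. -/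
noncomputable def basis (a : TorusCell I n) (f g : TraceMonoid I) (h : g * a.prod * f = α) :
    TorusChains I n α :=
  freeFunctorOf (cubicalFreeX (torusToFact I) n) (i := a) (x := ⟨α⟩) ⟨f, g, h⟩

theorem basis_congr {a a' : TorusCell I n} {f f' g g' : TraceMonoid I} (h : g * a.prod * f = α)
    (ha : a = a') (hf : f = f') (hg : g = g') :
    basis a f g h = basis a' f' g' (by rw [← ha, ← hf, ← hg, h]) := by
  subst ha hf hg
  rfl

theorem hom_ext {A : Type w} [AddCommGroup A] {φ ψ : TorusChains I n α →+ A}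
    (h : ∀ a f g h, φ (basis a f g h) = ψ (basis a f g h)) : φ = ψ :=
  freeFunctor_hom_ext (cubicalFreeX (torusToFact I) n) fun a m => h a m.f m.g m.mul_eq

/-- The homomorphism with given values on the basis. -/
noncomputable def lift {A : Type w} [AddCommGroup A]
    (φ : ∀ (a : TorusCell I n) (f g : TraceMonoid I), g * a.prod * f = α → A) :
    TorusChains I n α →+ A :=
  freeFunctorLift (cubicalFreeX (torusToFact I) n) fun a m => φ a m.f m.g m.mul_eq

theorem lift_basis {A : Type w} [AddCommGroup A]
    (φ : ∀ (a : TorusCell I n) (f g : TraceMonoid I), g * a.prod * f = α → A) (a f g h) :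
    lift φ (basis a f g h) = φ a f g h :=
  freeFunctorLift_of _ _ _ _

theorem map_mem_of_basis {A : Type w} [AddCommGroup A] (φ : TorusChains I n α →+ A)
    (K : AddSubgroup A) (h : ∀ a f g h, φ (basis a f g h) ∈ K) (z : TorusChains I n α) :
    φ z ∈ K := by
  have : (QuotientAddGroup.mk' K).comp φ = 0 :=
    hom_ext fun a f g hm => (QuotientAddGroup.eq_zero_iff _).2 (h a f g hm)
  exact (QuotientAddGroup.eq_zero_iff _).1 (DFunLike.congr_fun this z)

theorem mul_of_mul_face_prod {a : TorusCell I (n + 1)} {f g : TraceMonoid I}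
    (h : g * a.prod * f = α) (i : Fin (n + 1)) :
    g * TraceMonoid.of I (a.1 i) * (a.face i).prod * f = α := by
  rw [mul_assoc g, a.of_mul_face_prod, h]

theorem mul_face_prod_mul_of {a : TorusCell I (n + 1)} {f g : TraceMonoid I}
    (h : g * a.prod * f = α) (i : Fin (n + 1)) :
    g * (a.face i).prod * (TraceMonoid.of I (a.1 i) * f) = α := by
  rw [← mul_assoc, mul_assoc g, a.face_prod_mul, h]

/-- The difference of the two faces of `(a, f, g)` in direction `i`. -/
noncomputable def faceDiff (i : Fin (n + 1)) (a : TorusCell I (n + 1)) (f g : TraceMonoid I)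
    (h : g * a.prod * f = α) : TorusChains I n α :=
  basis (a.face i) f (g * TraceMonoid.of I (a.1 i)) (mul_of_mul_face_prod h i) -
    basis (a.face i) (TraceMonoid.of I (a.1 i) * f) g (mul_face_prod_mul_of h i)

variable (n α) in
/-- The differential. -/
noncomputable def d : TorusChains I (n + 1) α →+ TorusChains I n α :=
  ((cubicalFreeD (torusToFact I) n).hom.app ⟨α⟩).hom

theorem cubicalFreeFace_basis (i : Fin (n + 1)) (ε : Bool) (a : TorusCell I (n + 1))
    (f g : TraceMonoid I) (h : g * a.prod * f = α) :
    ((evalAt _ ⟨α⟩).map (cubicalFreeFace (torusToFact I) n i ε))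
      (freeFunctorOf (cubicalFreeX (torusToFact I) (n + 1)) (i := a) (x := ⟨α⟩) ⟨f, g, h⟩) =
    basis (a.face i) (TraceMonoid.of I (a.1 i) ^ (1 - ε.toNat) * f)
      (g * TraceMonoid.of I (a.1 i) ^ ε.toNat) (by
        cases ε
        · simpa using mul_face_prod_mul_of h i
        · simpa using mul_of_mul_face_prod h i) := by
  refine (freeMonomial_of _ _ _ _).trans ?_
  have hf := torusToFact_face (I := I) i ε a
  have h' := ((torusToFact I).map (faceOver (torus I) i ε a) ≫
    (⟨f, g, h⟩ : (torusToFact I).obj ⟨n + 1, a⟩ ⟶ ⟨α⟩)).mul_eq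
  refine (basis_congr (n := n) h' (a.cellFace_torus i ε) ?_ ?_)
  · exact congrArg (· * f) hf.1
  · exact congrArg (g * ·) hf.2

theorem d_basis (a : TorusCell I (n + 1)) (f g : TraceMonoid I) (h : g * a.prod * f = α) :
    d n α (basis a f g h) = ∑ i : Fin (n + 1), (-1 : ℤ) ^ (i.val + 1) • faceDiff i a f g h := by
  let A := (evalAt _ (⟨α⟩ : FactCat (TraceMonoid I))).obj (cubicalFreeX (torusToFact I) (n + 1))
  let B := (evalAt _ (⟨α⟩ : FactCat (TraceMonoid I))).obj (cubicalFreeX (torusToFact I) n)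
  let z : A := basis a f g h
  let ev : (A ⟶ B) →+ B := (AddMonoidHom.eval z).comp AddCommGrpCat.homAddEquiv.toAddMonoidHom
  refine (congrArg ev (map_cubicalFreeD (torusToFact I) (evalAt _ ⟨α⟩) n)).trans ?_
  refine (map_sum ev _ _).trans (Finset.sum_congr rfl fun i _ => ?_)
  refine (map_zsmul ev _ _).trans (congrArg (fun y : TorusChains I n α =>
    (-1 : ℤ) ^ (i.val + 1) • y) ?_)
  refine (map_sub ev _ _).trans (congrArg₂ (fun y y' : TorusChains I n α => y - y') ?_ ?_)
  · refine (cubicalFreeFace_basis i true a f g h).trans (basis_congr _ rfl ?_ ?_) <;> simp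
  · refine (cubicalFreeFace_basis i false a f g h).trans (basis_congr _ rfl ?_ ?_) <;> simp

theorem d_d (z : TorusChains I (n + 2) α) : d n α (d (n + 1) α z) = 0 := by
  have h := congrArg (evalAt _ (⟨α⟩ : FactCat (TraceMonoid I))).map
    (cubicalFreeD_comp (torusToFact I) n)
  exact (ConcreteCategory.congr_hom h z :)

variable (α) in
/-- The augmentation, with value `1` on the basis. -/
noncomputable def aug : TorusChains I 0 α →+ ULift.{u} ℤ :=
  ((augmentation (cubicalFreeX (torusToFact I) 0)).app ⟨α⟩).hom

theorem aug_basis (a : TorusCell I 0) (f g : TraceMonoid I) (h : g * a.prod * f = α) :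
    aug α (basis a f g h) = ULift.up 1 :=
  augmentation_of _ _ _

theorem aug_d (z : TorusChains I 1 α) : aug α (d 0 α z) = 0 := by
  have h : (aug α).comp (d 0 α) = 0 := hom_ext fun a f g h => by
    change aug α (d 0 α (basis a f g h)) = 0
    rw [d_basis, Fin.sum_univ_one, map_zsmul, faceDiff, map_sub, aug_basis, aug_basis, sub_self,
      smul_zero]
  exact DFunLike.congr_fun h z

variable (I) in
/-- The cell without letters. -/
def emptyCell : TorusCell I 0 := ⟨Fin.elim0, fun i => i.elim0⟩

/-- The identity has no decomposition `g a f = 1` with a cell `a` of positive dimension. -/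
theorem chains_one_succ_eq_zero (z : TorusChains I (n + 1) 1) : z = 0 := by
  have h : AddMonoidHom.id (TorusChains I (n + 1) 1) = 0 := hom_ext fun a f g h => by
    have h₁ := eq_one_and_eq_one_of_mul_eq_one (eq_one_and_eq_one_of_mul_eq_one h).1
    rw [← a.of_mul_face_prod 0] at h₁
    exact absurd (eq_one_and_eq_one_of_mul_eq_one h₁.2).1 (of_ne_one _)
  exact DFunLike.congr_fun h z

/-- At the identity, the only decomposition is the trivial one. -/
theorem chains_one_zero_eq (z : TorusChains I 0 1) :
    z = (aug 1 z).down • basis (emptyCell I) 1 1 (by rw [one_mul, mul_one]; rfl) := by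
  have h : AddMonoidHom.id (TorusChains I 0 1) = ((zmultiplesHom (TorusChains I 0 1)
      (basis (emptyCell I) 1 1 (by rw [one_mul, mul_one]; rfl))).comp
        AddEquiv.ulift.toAddMonoidHom).comp (aug 1) := hom_ext fun a f g h => by
    change basis a f g h = (aug 1 (basis a f g h)).down • _
    rw [aug_basis, one_smul]
    have h₁ := eq_one_and_eq_one_of_mul_eq_one h
    exact basis_congr h (Subtype.ext (Subsingleton.elim _ _)) h₁.2
      (eq_one_and_eq_one_of_mul_eq_one h₁.1).1
  exact DFunLike.congr_fun h z

/-! ### The contraction onto the chains whose right factor is divisible by a letter -/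

variable (b : E)

variable (n α) in
/-- The chain map sending `(a, f, g)` to `(a, f b, g)`. -/
noncomputable def mulLetter : TorusChains I n α →+ TorusChains I n (α * TraceMonoid.of I b) :=
  ((freeFunctor (cubicalFreeX (torusToFact I) n)).map
    (⟨TraceMonoid.of I b, 1, by rw [one_mul]⟩ :
      (⟨α⟩ : FactCat (TraceMonoid I)) ⟶ ⟨α * TraceMonoid.of I b⟩)).hom

theorem mulLetter_basis (a : TorusCell I n) (f g : TraceMonoid I) (h : g * a.prod * f = α) :
    mulLetter n α b (basis a f g h) =
      basis a (f * TraceMonoid.of I b) g (by rw [← mul_assoc, h]) := by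
  refine (freeFunctor_map_of _ _ _ _).trans ?_
  exact basis_congr (a := a) (f := f * TraceMonoid.of I b) (g := 1 * g)
    (by rw [one_mul, ← mul_assoc, h]) rfl rfl (one_mul g)

theorem d_mulLetter (z : TorusChains I (n + 1) α) :
    d n _ (mulLetter (n + 1) α b z) = mulLetter n α b (d n α z) :=
  NatTrans.naturality_apply (cubicalFreeD (torusToFact I) n).hom _ z

theorem aug_mulLetter (z : TorusChains I 0 α) : aug _ (mulLetter 0 α b z) = aug α z := by
  have h : (aug _).comp (mulLetter 0 α b) = aug α := hom_ext fun a f g h => by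
    change aug _ (mulLetter 0 α b (basis a f g h)) = _
    rw [mulLetter_basis, aug_basis, aug_basis]
  exact DFunLike.congr_fun h z

/-- The data exhibiting `(a, f, g)` as the face `ε = 1`, in the direction of the letter `b`, of a
triple `(c, f, g')` such that all letters of `f` are independent of `b`. -/
structure Insertion [Std.Irrefl I] [Std.Symm I] (a : TorusCell I n) (f g : TraceMonoid I) where
  pos : Fin (n + 1)
  cell : TorusCell I (n + 1)
  left : TraceMonoid I
  cell_pos : cell.1 pos = b
  face_eq : cell.face pos = a
  left_mul : left * TraceMonoid.of I b = g
  indep : endStatus b f = .indep f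

variable [Std.Irrefl I] [Std.Symm I]

variable {b}

instance (a : TorusCell I n) (f g : TraceMonoid I) : Subsingleton (Insertion b a f g) := by
  refine ⟨fun s t => ?_⟩
  obtain ⟨p, c, g', h₁, h₂, h₃, h₄⟩ := s
  obtain ⟨p', c', g'', h₁', h₂', h₃', -⟩ := t
  obtain ⟨rfl, rfl⟩ := TorusCell.eq_of_face_eq (h₁.trans h₁'.symm) (h₂.trans h₂'.symm)
  obtain rfl := mul_of_right_cancel (h₃.trans h₃'.symm)
  rfl

theorem Insertion.mul_eq {a : TorusCell I n} {f g : TraceMonoid I} (s : Insertion b a f g)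
    (h : g * a.prod * f = α) : s.left * s.cell.prod * f = α := by
  rw [← s.cell.of_mul_face_prod s.pos, s.cell_pos, s.face_eq, ← mul_assoc, s.left_mul, h]

variable (b) in
open Classical in
/-- The operator sending the face `ε = 1` in the direction of `b` of `(c, f, g)` to `± (c, f, g)` if
all letters of `f` are independent of `b`, and all other basis elements to `0`. -/
noncomputable def contraction (n : ℕ) (α : TraceMonoid I) :
    TorusChains I n α →+ TorusChains I (n + 1) α :=
  lift fun a f g h =>
    if hs : Nonempty (Insertion b a f g) then
      (-1 : ℤ) ^ (hs.some.pos.val + 1) • basis hs.some.cell f hs.some.left (hs.some.mul_eq h)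
    else 0

theorem contraction_basis {a : TorusCell I n} {f g : TraceMonoid I} (s : Insertion b a f g)
    (h : g * a.prod * f = α) :
    contraction b n α (basis a f g h) =
      (-1 : ℤ) ^ (s.pos.val + 1) • basis s.cell f s.left (s.mul_eq h) := by
  have hs : Nonempty (Insertion b a f g) := ⟨s⟩
  refine (lift_basis _ _ _ _ _).trans ((dif_pos hs).trans ?_)
  have e : hs.some = s := Subsingleton.elim _ _
  simp only [e]

theorem contraction_basis_eq_zero {a : TorusCell I n} {f g : TraceMonoid I}
    (h : g * a.prod * f = α) (hs : IsEmpty (Insertion b a f g)) :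
    contraction b n α (basis a f g h) = 0 :=
  (lift_basis _ _ _ _ _).trans (dif_neg (not_nonempty_iff.2 hs))

theorem isEmpty_insertion_of_divisible {a : TorusCell I n} {f f' g : TraceMonoid I}
    (hf : f = f' * TraceMonoid.of I b) : IsEmpty (Insertion b a f g) := ⟨fun s => by
  have := s.indep
  rw [hf, endStatus_mul_of] at this
  cases this⟩

theorem isEmpty_insertion_of_mem {a : TorusCell I n} {f g : TraceMonoid I} {k : Fin n}
    (hk : a.1 k = b) : IsEmpty (Insertion b a f g) := ⟨fun s => by
  have h : (s.cell.face s.pos).1 k = s.cell.1 s.pos := by rw [s.face_eq, hk, s.cell_pos]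
  exact s.pos.succAbove_ne k (s.cell.strictMono.injective h)⟩

theorem contraction_faceDiff_of_divisible {a : TorusCell I (n + 1)} {f f' g : TraceMonoid I}
    (h : g * a.prod * f = α) (hf : f = f' * TraceMonoid.of I b) (i : Fin (n + 1)) :
    contraction b n α (faceDiff i a f g h) = 0 := by
  rw [faceDiff, map_sub, contraction_basis_eq_zero _ (isEmpty_insertion_of_divisible hf),
    contraction_basis_eq_zero _ (isEmpty_insertion_of_divisible
      (f' := TraceMonoid.of I (a.1 i) * f') (by rw [hf, mul_assoc])), sub_zero]

theorem contraction_faceDiff_of_ne {a : TorusCell I (n + 1)} {f g : TraceMonoid I}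
    (h : g * a.prod * f = α) {p i : Fin (n + 1)} (hp : a.1 p = b) (hi : i ≠ p) :
    contraction b n α (faceDiff i a f g h) = 0 := by
  obtain ⟨k, hk⟩ := Fin.exists_succAbove_eq hi.symm
  have hk' : (a.face i).1 k = b := by rw [TorusCell.face_apply, hk, hp]
  rw [faceDiff, map_sub, contraction_basis_eq_zero _ (isEmpty_insertion_of_mem hk'),
    contraction_basis_eq_zero _ (isEmpty_insertion_of_mem hk'), sub_zero]

theorem contraction_faceDiff_of_eq {a : TorusCell I (n + 1)} {f g : TraceMonoid I}
    (h : g * a.prod * f = α) {p : Fin (n + 1)} (hp : a.1 p = b) (hf : endStatus b f = .indep f) :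
    contraction b n α (faceDiff p a f g h) = (-1 : ℤ) ^ (p.val + 1) • basis a f g h := by
  have hc := (eq_and_commute_of_endStatus_eq_indep hf).2
  have e₁ := contraction_basis (b := b) (a := a.face p) (f := f)
    (g := g * TraceMonoid.of I (a.1 p)) ⟨p, a, g, hp, rfl, by rw [hp], hf⟩
    (mul_of_mul_face_prod h p)
  rw [faceDiff, map_sub, e₁, contraction_basis_eq_zero _ (isEmpty_insertion_of_divisible
      (f' := f) (by rw [hp, hc.eq])), sub_zero]

/-- Faces in the directions other than `b` commute with the insertion of `b`. -/
theorem contraction_faceDiff_of_insertion {a : TorusCell I (n + 1)} {f g : TraceMonoid I}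
    (s : Insertion b a f g) (h : g * a.prod * f = α) (k : Fin (n + 1)) :
    contraction b n α (faceDiff k a f g h) = (-1 : ℤ) ^ ((k.predAbove s.pos).val + 1) •
      faceDiff (s.pos.succAbove k) s.cell f s.left (s.mul_eq h) := by
  obtain ⟨p, c, g', hp, rfl, rfl, hf⟩ := s
  have hb : (c.face (p.succAbove k)).1 (k.predAbove p) = b := by
    rw [TorusCell.face_apply, Fin.succAbove_succAbove_predAbove, hp]
  have hI : I (c.1 (p.succAbove k)) b := by
    have hne := p.succAbove_ne k
    rw [← hp]
    rcases lt_or_gt_of_ne hne with hlt | hlt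
    · exact (c.2 _ _ hlt).2
    · exact Std.Symm.symm _ _ (c.2 _ _ hlt).2
  have hfk : endStatus b (TraceMonoid.of I (c.1 (p.succAbove k)) * f) =
      .indep (TraceMonoid.of I (c.1 (p.succAbove k)) * f) := by
    rw [endStatus_of_mul, hf, EndStatus.letter, if_neg, if_pos hI]
    intro e
    rw [e] at hI
    exact Std.Irrefl.irrefl (r := I) _ hI
  have e₁ := contraction_basis (b := b) (a := (c.face p).face k) (f := f)
    (g := g' * TraceMonoid.of I b * TraceMonoid.of I (c.1 (p.succAbove k)))
    ⟨k.predAbove p, c.face (p.succAbove k), g' * TraceMonoid.of I (c.1 (p.succAbove k)), hb,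
      (TorusCell.face_face p k c).symm, by rw [mul_assoc, (of_commute hI).eq, mul_assoc], hf⟩
    (mul_of_mul_face_prod h k)
  have e₂ := contraction_basis (b := b) (a := (c.face p).face k)
    (f := TraceMonoid.of I (c.1 (p.succAbove k)) * f) (g := g' * TraceMonoid.of I b)
    ⟨k.predAbove p, c.face (p.succAbove k), g', hb, (TorusCell.face_face p k c).symm, rfl, hfk⟩
    (mul_face_prod_mul_of h k)
  refine (map_sub _ _ _).trans ((congrArg₂ (· - ·) e₁ e₂).trans ?_)
  exact (smul_sub _ _ _).symm

/-- The effect of `d ∘ contraction` on a basis element with an insertion of `b`. -/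
theorem d_contraction_of_insertion {a : TorusCell I n} {f g : TraceMonoid I}
    (s : Insertion b a f g) (h : g * a.prod * f = α) :
    d n α (contraction b n α (basis a f g h)) =
      faceDiff s.pos s.cell f s.left (s.mul_eq h) -
        ∑ k : Fin n, (-1 : ℤ) ^ (s.pos.val + (s.pos.succAbove k).val + 1) •
          faceDiff (s.pos.succAbove k) s.cell f s.left (s.mul_eq h) := by
  rw [contraction_basis s, map_zsmul, d_basis, Fin.sum_univ_succAbove _ s.pos, smul_add, smul_smul,
    ← mul_pow, neg_one_mul, neg_neg, one_pow, one_smul, sub_eq_add_neg, Finset.smul_sum,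
    ← Finset.sum_neg_distrib]
  refine congrArg _ (Finset.sum_congr rfl fun k _ => ?_)
  rw [smul_smul, ← neg_smul]
  congr 1
  ring

open Classical in
theorem mulLetter_injective : Function.Injective (mulLetter n α b) := by
  -- By right cancellation, dividing the right factor by `b` is well defined.
  let κ : TorusChains I n (α * TraceMonoid.of I b) →+ TorusChains I n α :=
    lift fun a f g h =>
      if hf : ∃ f', f = f' * TraceMonoid.of I b then
        basis a hf.choose g (mul_of_right_cancel (b := b) (by
          rw [mul_assoc, ← hf.choose_spec, h]))
      else 0
  have hκ : κ.comp (mulLetter n α b) = AddMonoidHom.id _ := by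
    refine hom_ext fun a f g h => ?_
    refine (congrArg κ (mulLetter_basis b a f g h)).trans ((lift_basis _ _ _ _ _).trans ?_)
    have hf : ∃ f', f * TraceMonoid.of I b = f' * TraceMonoid.of I b := ⟨f, rfl⟩
    refine (dif_pos hf).trans (basis_congr _ rfl ?_ rfl)
    exact (mul_of_right_cancel hf.choose_spec).symm
  exact Function.LeftInverse.injective (g := κ) fun z => DFunLike.congr_fun hκ z

theorem basis_mem_range_mulLetter {a : TorusCell I n} {f f' g : TraceMonoid I}
    (h : g * a.prod * f = α * TraceMonoid.of I b) (hf : f = f' * TraceMonoid.of I b) :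
    basis a f g h ∈ (mulLetter n α b).range := by
  subst hf
  exact ⟨basis a f' g (mul_of_right_cancel (b := b) (by rw [mul_assoc, h])),
    mulLetter_basis _ _ _ _ _⟩

/-- If `b` divides `g a f` on the right, then `b` divides `f`, or `f` is independent of `b` and `b`
is a letter of `a`, or `(a, f, g)` admits an insertion of `b`. -/
theorem right_division_cases_cell {a : TorusCell I n} {f g : TraceMonoid I}
    (h : g * a.prod * f = α * TraceMonoid.of I b) :
    (∃ f', f = f' * TraceMonoid.of I b) ∨ (endStatus b f = .indep f ∧ ∃ p, a.1 p = b) ∨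
      Nonempty (Insertion b a f g) := by
  rw [a.prod_eq_list_prod] at h
  rcases right_division_cases h with h | ⟨h, hb⟩ | ⟨h, hI, g', hg⟩
  · exact Or.inl h
  · obtain ⟨p, hp⟩ := List.mem_ofFn.1 hb
    exact Or.inr (Or.inl ⟨h, p, hp⟩)
  · obtain ⟨p, c, hp, hc⟩ := a.exists_face_eq fun k => hI _ (List.mem_ofFn.2 ⟨k, rfl⟩)
    exact Or.inr (Or.inr ⟨⟨p, c, g', hp, hc, hg.symm, h⟩⟩)

/-- The face in the direction of `b` of an inserted cell is the original element up to an element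
whose right factor is divisible by `b`. -/
theorem sub_faceDiff_mem_range {a : TorusCell I n} {f g : TraceMonoid I} (s : Insertion b a f g)
    (h : g * a.prod * f = α * TraceMonoid.of I b) :
    basis a f g h - faceDiff s.pos s.cell f s.left (s.mul_eq h) ∈ (mulLetter n α b).range := by
  have e : basis (s.cell.face s.pos) f (s.left * TraceMonoid.of I (s.cell.1 s.pos))
      (mul_of_mul_face_prod (s.mul_eq h) s.pos) = basis a f g h :=
    basis_congr _ s.face_eq rfl (by rw [s.cell_pos, s.left_mul])
  rw [faceDiff, e, sub_sub_cancel]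
  refine basis_mem_range_mulLetter (f' := f) _ ?_
  rw [s.cell_pos, (eq_and_commute_of_endStatus_eq_indep s.indep).2.eq]

/-- The contraction is a homotopy from the identity to a map into the chains whose right factor is
divisible by `b`. -/
theorem homotopy_mem_range (z : TorusChains I (n + 1) (α * TraceMonoid.of I b)) :
    z - d (n + 1) _ (contraction b (n + 1) _ z) - contraction b n _ (d n _ z) ∈
      (mulLetter (n + 1) α b).range := by
  refine map_mem_of_basis (AddMonoidHom.id _ -
    (d (n + 1) _).comp (contraction b (n + 1) (α * TraceMonoid.of I b)) -
    (contraction b n _).comp (d n _)) _ (fun a f g h => ?_) z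
  change basis a f g h - d (n + 1) _ (contraction b (n + 1) _ (basis a f g h)) -
    contraction b n _ (d n _ (basis a f g h)) ∈ _
  rw [d_basis a, map_sum]
  simp only [map_zsmul]
  rcases right_division_cases_cell h with ⟨f', hf⟩ | ⟨hf, p, hp⟩ | ⟨⟨s⟩⟩
  -- If `b` divides `f`, the contraction vanishes on `(a, f, g)` and on its faces.
  · rw [contraction_basis_eq_zero _ (isEmpty_insertion_of_divisible hf), map_zero, sub_zero,
      Finset.sum_eq_zero fun i _ => by rw [contraction_faceDiff_of_divisible h hf, smul_zero],
      sub_zero]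
    exact basis_mem_range_mulLetter h hf
  -- If `b` is the letter `p` of `a`, only the `p`-th face contributes, and gives back `(a, f, g)`.
  · rw [contraction_basis_eq_zero _ (isEmpty_insertion_of_mem hp), map_zero, sub_zero,
      Finset.sum_eq_single p
        (fun i _ hi => by rw [contraction_faceDiff_of_ne h hp hi, smul_zero])
        (fun hi => absurd (Finset.mem_univ p) hi),
      contraction_faceDiff_of_eq h hp hf, smul_smul, ← mul_pow, neg_one_mul, neg_neg, one_pow,
      one_smul, sub_self]
    exact zero_mem _
  -- If `b` can be inserted, the faces in the directions other than `b` cancel.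
  · rw [d_contraction_of_insertion s]
    have hs : ∑ k : Fin (n + 1), (-1 : ℤ) ^ (k.val + 1) •
        contraction b n _ (faceDiff k a f g h) = ∑ k : Fin (n + 1),
          (-1 : ℤ) ^ (s.pos.val + (s.pos.succAbove k).val + 1) •
            faceDiff (s.pos.succAbove k) s.cell f s.left (s.mul_eq h) := by
      refine Finset.sum_congr rfl fun k _ => ?_
      rw [contraction_faceDiff_of_insertion s, smul_smul]
      congr 1
      have hsq : ∀ m : ℕ, (-1 : ℤ) ^ m * (-1) ^ m = 1 := fun m => by
        rw [← mul_pow, neg_one_mul, neg_neg, one_pow]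
      have hsign := Fin.neg_one_pow_succAbove_add_predAbove (R := ℤ) s.pos k
      simp only [pow_add, pow_one] at hsign ⊢
      linear_combination (-1 : ℤ) ^ k.val * (-1) ^ (s.pos.succAbove k).val * hsign -
        (-1) ^ k.val * (-1) ^ (k.predAbove s.pos).val * hsq (s.pos.succAbove k).val -
        (-1) ^ s.pos.val * (-1) ^ (s.pos.succAbove k).val * hsq k.val
    rw [hs, sub_sub, sub_add_cancel]
    exact sub_faceDiff_mem_range s h

theorem homotopy_zero_mem_range (z : TorusChains I 0 (α * TraceMonoid.of I b)) :
    z - d 0 _ (contraction b 0 _ z) ∈ (mulLetter 0 α b).range := by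
  refine map_mem_of_basis (AddMonoidHom.id _ -
    (d 0 _).comp (contraction b 0 (α * TraceMonoid.of I b))) _ (fun a f g h => ?_) z
  change basis a f g h - d 0 _ (contraction b 0 _ (basis a f g h)) ∈ _
  rcases right_division_cases_cell h with ⟨f', hf⟩ | ⟨hf, p, hp⟩ | ⟨⟨s⟩⟩
  · rw [contraction_basis_eq_zero _ (isEmpty_insertion_of_divisible hf), map_zero, sub_zero]
    exact basis_mem_range_mulLetter h hf
  · exact p.elim0
  · rw [d_contraction_of_insertion s, Finset.univ_eq_empty, Finset.sum_empty, sub_zero]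
    exact sub_faceDiff_mem_range s h

/-! ### The resolution given by the generalized torus -/

/-- By induction on `α` on the right: the homotopy moves a cycle at `α b` into the image of the
injective chain map `mulLetter`, where it comes from a cycle at `α`. -/
theorem exact_succ (α : TraceMonoid I) (n : ℕ) (z : TorusChains I (n + 1) α) (hz : d n α z = 0) :
    ∃ y, d (n + 1) α y = z := by
  induction α using induction_right with
  | one => exact ⟨0, by rw [map_zero, chains_one_succ_eq_zero z]⟩
  | mul α b ih =>
    obtain ⟨w, hw⟩ := homotopy_mem_range z
    rw [hz, map_zero, sub_zero] at hw
    have hdw : d n α w = 0 := mulLetter_injective (b := b) (by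
      rw [← d_mulLetter, hw, map_sub, hz, d_d, sub_zero, map_zero])
    obtain ⟨y, rfl⟩ := ih w hdw
    exact ⟨contraction b (n + 1) _ z + mulLetter (n + 2) α b y, by
      rw [map_add, d_mulLetter, hw, add_sub_cancel]⟩

theorem exact_zero (α : TraceMonoid I) (z : TorusChains I 0 α) (hz : aug α z = 0) :
    ∃ y, d 0 α y = z := by
  induction α using induction_right with
  | one => exact ⟨0, by rw [map_zero, chains_one_zero_eq z, hz, ULift.zero_down, zero_smul]⟩
  | mul α b ih =>
    obtain ⟨w, hw⟩ := homotopy_zero_mem_range z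
    have hdw : aug α w = 0 := by
      rw [← aug_mulLetter b, hw, map_sub, hz, aug_d, sub_zero]
    obtain ⟨y, rfl⟩ := ih w hdw
    exact ⟨contraction b 0 _ z + mulLetter 1 α b y, by
      rw [map_add, d_mulLetter, hw, add_sub_cancel]⟩

end TorusChains

variable (I) in
theorem torus_isFreeResolution [Std.Irrefl I] [Std.Symm I] :
    IsFreeResolution (cubicalFreeComplex (torusToFact I)) where
  d_augmentation x z := by
    rw [cubicalFreeComplex_d]
    exact TorusChains.aug_d (α := x.val) z
  surjective x := ⟨TorusChains.basis (TorusChains.emptyCell I) x.val 1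
    (by rw [one_mul]; exact one_mul _), TorusChains.aug_basis _ _ _ _⟩
  exact₀ x z hz := by
    rw [cubicalFreeComplex_d]
    exact TorusChains.exact_zero x.val z hz
  exact_succ n x z hz := by
    rw [cubicalFreeComplex_d] at hz ⊢
    exact TorusChains.exact_succ x.val n z hz

end TorusExact

/-! ### Finiteness -/

section Finiteness

variable {E : Type u} [LinearOrder E] (I : E → E → Prop)

theorem finite_sigma_torusCell [Finite E] : Finite (Σ n : ℕ, TorusCell I n) := by
  refine Finite.of_injective (fun a : Σ n : ℕ, TorusCell I n => Set.range a.2.1) ?_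
  rintro ⟨m, a⟩ ⟨n, b⟩ (h : Set.range a.1 = Set.range b.1)
  have hm : m = n := by
    have := congrArg Set.ncard h
    rwa [Set.ncard_range_of_injective a.strictMono.injective,
      Set.ncard_range_of_injective b.strictMono.injective, Nat.card_fin, Nat.card_fin] at this
  subst hm
  rw [TorusCell.ext_of_range_eq h]

theorem isEmpty_torusCell [Finite E] {n : ℕ} (hn : Nat.card E < n) : IsEmpty (TorusCell I n) :=
  ⟨fun a => by
    have := Nat.card_le_card_of_injective a.1 a.strictMono.injective
    rw [Nat.card_fin] at this
    omega⟩

theorem isZero_abSum_of_isEmpty {ι : Type u} [IsEmpty ι] (A : ι → AddCommGrpCat.{w}) :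
    Limits.IsZero (abSum A) :=
  (Limits.IsZero.iff_id_eq_zero _).2 (abSum_ext _ _ fun i => isEmptyElim i)

end Finiteness

theorem mainTheorem1 {E : Type u} [LinearOrder E] (I : E → E → Prop)
    (hirrefl : ∀ a, ¬ I a a) (hsymm : ∀ a b, I a b → I b a)
    (hfin : ∀ A : Set E, A.Pairwise I → A.Finite) :
    (∀ n : ℕ, Nonempty
      ((categoryHomology (FactCat (TraceMonoid I))ᵒᵖ n :
          ((FactCat (TraceMonoid I))ᵒᵖ ⥤ AddCommGrpCat.{w}) ⥤ AddCommGrpCat.{max u w}) ≅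
        (Functor.whiskeringLeft _ _ _).obj (torusToFact I).op ⋙
          cubicalHomology (torus I) n)) ∧
    (Finite E →
      Finite (Σ n : ℕ, TorusCell I n) ∧
      ∀ (F : (FactCat (TraceMonoid I))ᵒᵖ ⥤ AddCommGrpCat.{w}) (n : ℕ), Nat.card E < n →
        Limits.IsZero (((cubicalComplex (torus I)).obj ((torusToFact I).op ⋙ F)).X n)) := by
  have : Std.Irrefl I := ⟨hirrefl⟩
  have : Std.Symm I := ⟨hsymm⟩
  refine ⟨fun n =>
      ⟨categoryHomologyIsoCubicalHomology (torusToFact I) (torus_isFreeResolution I) n⟩,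
    fun _ => ⟨finite_sigma_torusCell I, fun F n hn => ?_⟩⟩
  have : IsEmpty ((torus I).obj (op ⟨n⟩)) := isEmpty_torusCell I hn
  exact isZero_abSum_of_isEmpty _
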